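/- **Conventions.** For a finite alphabet $\Sigma$, a subshift is a closed shift-invariant set $X\subset\Sigma^{\mathbb Z}$. For $x\in X$ let $\Gamma_X^+(x^-)$, $x^-=(x_i)_{i\le 0}$, be the set of sequences $x^+\in\Sigma^{\mathbb N}$ with $(x^-,x^+)\in X$, and let $\mathcal V(X)$ be the closure of $\{\Gamma_X^+(x^-):x\in X\}$ in the space of closed subsets of $\Sigma^{\mathbb N}$ with the Hausdorff topology. There is an edge labeled $\sigma$ from $C$ to $C'$ if some sequence in $C$ begins with $\sigma$ and $C'=\tau_\sigma(C)=\{(v_2,v_3,\dots): v\in C,\ v_1=\sigma\}$; the same rule defines edges from sets of words of length $n$ to sets of words of length $n-1$. Let $Y\subset X$ be subshifts. The pair graph $[\mathcal V(Y),\mathcal V(X)]$ has as vertices the pairs $(C_Y,C_X)\in\mathcal V(Y)\times\mathcal V(X)$ with $C_Y\subset C_X$, and as edges labeled $\sigma$ the pairs of edges labeled $\sigma$. For a set $S$ of its vertices let $\tau(S)$ be the set of final vertices of edges leaving $S$; let $\mathcal V(Y,X)=\bigcap_{n\ge 1}\tau^n([\mathcal V(Y),\mathcal V(X)])$, and let $\mathcal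 V_n(Y,X)$, $n\ge 0$, be the set of pairs of sets of initial words of length $n$ of the pairs in $\mathcal V(Y,X)$. With the edges labeled $\sigma$ acting on both components, and with $\iota$ removing the last symbol of all words, $\bigcup_{n\ge 0}\mathcal V_n(Y,X)$ is a $\lambda$-graph system over $\Sigma$. The separation entropy of $Y$ in $X$ is its $\lambda$-entropy $\limsup_n\frac1n\log\#\mathcal V_n(Y,X)\in[-\infty,\infty]$ (with $\log 0=-\infty$). Here a ($1$-right resolving) $\lambda$-graph system over a finite alphabet $\Sigma$ consists of finite vertex sets $V_n$, $n\ge 0$, of edges from $V_n$ to $V_{n-1}$ ($n\ge1$) labeled in $\Sigma$, at most one edge with a given label leaving a vertex, such that every vertex has an incoming edge and every vertex outside $V_0$ an outgoing one, and of surjections $\iota:V_n\to V_{n-1}$ ($n\ge 1$) compatible with the labeling: $\tau_\sigma\circ\iota=\iota\circ\tau_\sigma$ on $V_n$, $n\ge 2$, domains included. Let $M^{(n,n-1)}$ be the symbolic adjacency matrix (its entries are formal sums of symbols) and $I^{(n,n-1)}$ the $0$-$1$ matrix of $\iota$. Two such systems $(M,I)$ over $\Sigma$ and $(\widetilde M,\widetilde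 I)$ over $\widetilde\Sigma$ are strong shift equivalent in one step if there are disjoint finite alphabets $\Delta,\widetilde\Delta$, injections $f:\Sigma\to\Delta\widetilde\Delta$ and $\tilde f:\widetilde\Sigma\to\widetilde\Delta\Delta$ such that the words obtained from $f(a)f(b)$, $ab$ a label sequence of a path of length two of the first system, by deleting the first and the last symbol are exactly the words $\tilde f(c)$, $c$ a label of the second system, and symmetrically, and symbolic matrices $K^{(n,n-1)}$ over $\Delta$ (rows $V_n$, columns $\widetilde V_{n-1}$) and $\widetilde K^{(n,n-1)}$ over $\widetilde\Delta$ (rows $\widetilde V_n$, columns $V_{n-1}$) such that for all $n\ge 1$ $$K^{(n+1,n)}\widetilde K^{(n,n-1)}=f(M^{(n+1,n)}I^{(n,n-1)}),\quad K^{(n+1,n)}\tilde f(\widetilde M^{(n,n-1)})=f(M^{(n+1,n)})K^{(n,n-1)},\quad K^{(n+1,n)}\widetilde I^{(n,n-1)}=I^{(n+1,n)}K^{(n,n-1)},$$ together with the three relations obtained by exchanging the two systems. They are strong shift equivalent if they are joined by a finite chain of one-step strong shift equivalences. **Theorem 4.2.** Let $X\subset\Sigma^{\mathbb Z}$ and $\widetilde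 X\subset\widetilde\Sigma^{\mathbb Z}$ be subshifts over finite alphabets, let $\varphi:X\to\widetilde X$ be a topological conjugacy of $X$ onto $\widetilde X$, let $Y\subset X$ be a subshift, and set $\widetilde Y=\varphi(Y)$. Then the $\lambda$-graph systems $\bigcup_n\mathcal V_n(Y,X)$ and $\bigcup_n\mathcal V_n(\widetilde Y,\widetilde X)$ are strong shift equivalent. Hence their strong shift equivalence classes coincide, and the separation entropy of $Y$ in $X$ equals that of $\widetilde Y$ in $\widetilde X$. -/

import Mathlib

universe u

namespace SubshiftPair

open Set Function
open scoped ENNReal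

/-! ### Symbolic matrices -/

/-- An `I × J` symbolic matrix over the finite alphabet `A`: its entries are finite formal sums of
elements of `A`, and `P i j a` is the multiplicity of the summand `a` in the entry `(i, j)`. -/
abbrev SymbolicMatrix (I J A : Type u) : Type u := I → J → A → ℕ

namespace SymbolicMatrix

variable {I J K A B : Type u}

/-- Product of symbolic matrices; the symbol `a` times the symbol `b` is the word `ab`, written as
the pair `(a, b)`. -/
def mul [Fintype J] (P : SymbolicMatrix I J A) (Q : SymbolicMatrix J K B) :
    SymbolicMatrix I K (A × B) :=
  fun i k w => ∑ j, P i j w.1 * Q j k w.2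

/-- Product `P N` of a symbolic matrix and a matrix of natural numbers. -/
def mulNat [Fintype J] (P : SymbolicMatrix I J A) (N : J → K → ℕ) : SymbolicMatrix I K A :=
  fun i k a => ∑ j, P i j a * N j k

/-- Product `N P` of a matrix of natural numbers and a symbolic matrix. -/
def natMul [Fintype J] (N : I → J → ℕ) (P : SymbolicMatrix J K A) : SymbolicMatrix I K A :=
  fun i k a => ∑ j, N i j * P j k a

open Classical in
/-- A map `f` of symbols, applied to every entry (and extended additively to formal sums). -/
noncomputable def map [Fintype A] (f : A → B) (P : SymbolicMatrix I J A) : SymbolicMatrix I J B :=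
  fun i j b => ∑ a, if f a = b then P i j a else 0

end SymbolicMatrix

/-! ### λ-graph systems -/

/-- The data of a λ-graph system: a finite alphabet, finite sets `V n` of vertices, labeled edges
going from `V (n + 1)` to `V n`, and the shift-like map `ι`. -/
structure LabeledBratteli : Type (u + 1) where
  Alphabet : Type u
  [fintypeAlphabet : Fintype Alphabet]
  V : ℕ → Type u
  [fintypeV : ∀ n, Fintype (V n)]
  /-- `edge n c a c'`: there is an edge from `c` to `c'` that carries the label `a`. -/
  edge : ∀ n, V (n + 1) → Alphabet → V n → Prop
  ι : ∀ n, V (n + 1) → V n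

attribute [instance] LabeledBratteli.fintypeAlphabet LabeledBratteli.fintypeV

namespace LabeledBratteli

/-- `L` is a (Shannon, that is, 1-right resolving) λ-graph system. -/
structure IsLambdaGraphSystem (L : LabeledBratteli.{u}) : Prop where
  right_resolving : ∀ n c a c' c'', L.edge n c a c' → L.edge n c a c'' → c' = c''
  exists_outgoing : ∀ n c, ∃ a c', L.edge n c a c'
  exists_incoming : ∀ n c', ∃ c a, L.edge n c a c'
  ι_surjective : ∀ n, Surjective (L.ι n)
  /-- compatibility of `ι` with the labeling: `τ_a ∘ ι = ι ∘ τ_a`, including domains -/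
  compatible : ∀ n (c : L.V (n + 2)) (a : L.Alphabet) (c' : L.V n),
    (∃ d, L.edge (n + 1) c a d ∧ L.ι n d = c') ↔ L.edge n (L.ι (n + 1) c) a c'

open Classical in
/-- The symbolic adjacency matrix `M^(n+1, n)`. -/
noncomputable def M (L : LabeledBratteli.{u}) (n : ℕ) :
    SymbolicMatrix (L.V (n + 1)) (L.V n) L.Alphabet :=
  fun c c' a => if L.edge n c a c' then 1 else 0

open Classical in
/-- The 0-1 matrix `I^(n+1, n)` of `ι`. -/
noncomputable def I (L : LabeledBratteli.{u}) (n : ℕ) : L.V (n + 1) → L.V n → ℕ :=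
  fun c c' => if L.ι n c = c' then 1 else 0

/-- The symbol `a` is the label of an edge. -/
def IsLabel (L : LabeledBratteli.{u}) (a : L.Alphabet) : Prop :=
  ∃ n c c', L.edge n c a c'

/-- The word `ab` is the label sequence of a path of length two. -/
def IsLabelWord (L : LabeledBratteli.{u}) (a b : L.Alphabet) : Prop :=
  ∃ n c d e, L.edge (n + 1) c a d ∧ L.edge n d b e

/-- `φ : Σ → D E` and `ψ : Σ' → E D` are a pair of specifications for `L` and `L'`: injections such
that the words obtained from the words `φ(ab)`, `ab` admissible for `L`, by removing the first and
the last symbol are exactly the words `ψ(c)`, `c` admissible for `L'`, and symmetrically. -/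
structure IsSpecificationPair (L L' : LabeledBratteli.{u}) {D E : Type u}
    (φ : L.Alphabet → D × E) (ψ : L'.Alphabet → E × D) : Prop where
  injective_left : Injective φ
  injective_right : Injective ψ
  middle_left : ∀ w : E × D,
    (∃ a b, L.IsLabelWord a b ∧ ((φ a).2, (φ b).1) = w) ↔ ∃ c, L'.IsLabel c ∧ ψ c = w
  middle_right : ∀ w : D × E,
    (∃ a b, L'.IsLabelWord a b ∧ ((ψ a).2, (ψ b).1) = w) ↔ ∃ c, L.IsLabel c ∧ φ c = w

/-- The relations that the symbolic matrices `K n = 𝒦^(n+1, n)` and `K' n = 𝒦̃^(n+1, n)` of a 1-step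
strong shift equivalence have to satisfy. Words of length three occurring on the two sides of a
relation are compared letter by letter. -/
structure OneStepRelations (L L' : LabeledBratteli.{u}) {D E : Type u}
    (φ : L.Alphabet → D × E) (ψ : L'.Alphabet → E × D)
    (K : ∀ n, SymbolicMatrix (L.V (n + 1)) (L'.V n) D)
    (K' : ∀ n, SymbolicMatrix (L'.V (n + 1)) (L.V n) E) : Prop where
  mul_left : ∀ n, (K (n + 1)).mul (K' n) = ((L.M (n + 1)).mulNat (L.I n)).map φ
  mul_right : ∀ n, (K' (n + 1)).mul (K n) = ((L'.M (n + 1)).mulNat (L'.I n)).map ψ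
  comm_left : ∀ n i j d e d',
    (K (n + 1)).mul ((L'.M n).map ψ) i j (d, (e, d')) =
      ((L.M (n + 1)).map φ).mul (K n) i j ((d, e), d')
  comm_right : ∀ n i j e d e',
    (K' (n + 1)).mul ((L.M n).map φ) i j (e, (d, e')) =
      ((L'.M (n + 1)).map ψ).mul (K' n) i j ((e, d), e')
  comm_ι_left : ∀ n, (K (n + 1)).mulNat (L'.I n) = SymbolicMatrix.natMul (L.I (n + 1)) (K n)
  comm_ι_right : ∀ n, (K' (n + 1)).mulNat (L.I n) = SymbolicMatrix.natMul (L'.I (n + 1)) (K' n)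

/-- `L` and `L'` are λ-graph systems that are strong shift equivalent in one step. The two
alphabets `D` and `E` are separate types, hence disjoint. -/
def OneStepStrongShiftEquivalent (L L' : LabeledBratteli.{u}) : Prop :=
  L.IsLambdaGraphSystem ∧ L'.IsLambdaGraphSystem ∧
    ∃ (D E : Type u) (_ : Finite D) (_ : Finite E)
      (φ : L.Alphabet → D × E) (ψ : L'.Alphabet → E × D)
      (K : ∀ n, SymbolicMatrix (L.V (n + 1)) (L'.V n) D)
      (K' : ∀ n, SymbolicMatrix (L'.V (n + 1)) (L.V n) E),
      IsSpecificationPair L L' φ ψ ∧ OneStepRelations L L' φ ψ K K'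

/-- Strong shift equivalence: a finite chain of 1-step strong shift equivalences. -/
def StrongShiftEquivalent : LabeledBratteli.{u} → LabeledBratteli.{u} → Prop :=
  Relation.TransGen OneStepStrongShiftEquivalent

/-- The λ-entropy: the upper exponential growth rate `limsup (1/n) log #(V n)`, in `[-∞, ∞]`. -/
noncomputable def lambdaEntropy (L : LabeledBratteli.{u}) : EReal :=
  ExpGrowth.expGrowthSup fun n => (Fintype.card (L.V n) : ℝ≥0∞)

end LabeledBratteli

/-! ### The λ-graph system of a subshift of a subshift

A right-infinite sequence `(x_1, x_2, …)` is stored as `r : ℕ → A` with `r i = x_{i+1}`. -/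

section

variable {A : Type u}

/-- `Γ⁺(x⁻)` for the left-infinite sequence `x⁻ = (x_i)_{i ≤ 0}`: the right-infinite sequences `r`
such that `(x⁻, r) ∈ X`. -/
def followerSet (X : Set (ℤ → A)) (x : ℤ → A) : Set (ℕ → A) :=
  {r | ∃ z ∈ X, (∀ i ≤ 0, z i = x i) ∧ ∀ i : ℕ, z (i + 1) = r i}

/-- The vertex set of the Shannon graph `𝒱(X)`: the closure of the set of all `Γ⁺(x⁻)` in the space
of closed sets of right-infinite sequences with the Hausdorff subset topology (which, the space of
sequences being compact, is the Vietoris topology). -/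
def shannonVertices [TopologicalSpace A] (X : Set (ℤ → A)) : Set (Set (ℕ → A)) :=
  {C | IsClosed C ∧ C ∈ @closure _ (TopologicalSpace.vietoris (ℕ → A)) (followerSet X '' X)}

/-- There is an edge labeled `a` from `C` to `C'`: some sequence in `C` begins with `a`, and
`C' = τ_a(C)` is the set of the sequences in `C` beginning with `a`, with that `a` removed. -/
def SeqEdge (C : Set (ℕ → A)) (a : A) (C' : Set (ℕ → A)) : Prop :=
  (∃ r ∈ C, r 0 = a) ∧ C' = {s | ∃ r ∈ C, r 0 = a ∧ s = fun i => r (i + 1)}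

/-- The analogous edges between sets of words. -/
def WordEdge {n : ℕ} (C : Set (Fin (n + 1) → A)) (a : A) (C' : Set (Fin n → A)) : Prop :=
  (∃ v ∈ C, v 0 = a) ∧ C' = {w | ∃ v ∈ C, v 0 = a ∧ w = Fin.tail v}

/-- The vertex set of the pair Shannon graph `[𝒱(Y), 𝒱(X)]`. (A vertex of `𝒱(Y)` or `𝒱(X)` is its
own forward context.) -/
def pairVertices [TopologicalSpace A] (Y X : Set (ℤ → A)) :
    Set (Set (ℕ → A) × Set (ℕ → A)) :=
  {p | p.1 ∈ shannonVertices Y ∧ p.2 ∈ shannonVertices X ∧ p.1 ⊆ p.2}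

/-- `τ(S)`: the final vertices of the edges, in the pair Shannon graph, that leave a vertex
in `S`. -/
def pairSuccessors (S : Set (Set (ℕ → A) × Set (ℕ → A))) :
    Set (Set (ℕ → A) × Set (ℕ → A)) :=
  {q | ∃ p ∈ S, ∃ a, SeqEdge p.1 a q.1 ∧ SeqEdge p.2 a q.2}

/-- The vertex set of `𝒱(Y, X) = [𝒱(Y), 𝒱(X)]°`: the intersection of the sets
`τ⁽ⁿ⁾ = τ^{n+1}` applied to the vertex set of `[𝒱(Y), 𝒱(X)]`. -/
def coreVertices [TopologicalSpace A] (Y X : Set (ℤ → A)) :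
    Set (Set (ℕ → A) × Set (ℕ → A)) :=
  ⋂ n : ℕ, pairSuccessors^[n + 1] (pairVertices Y X)

/-- `C_{[1,n]}`, the set of initial words of length `n` of the sequences in `C`. -/
def initialWords (n : ℕ) (C : Set (ℕ → A)) : Set (Fin n → A) :=
  (fun (r : ℕ → A) (i : Fin n) => r i) '' C

/-- The set `𝒱_n(Y, X) = 𝒱(Y, X)_{[1,n]}`. -/
def levelVertices [TopologicalSpace A] (Y X : Set (ℤ → A)) (n : ℕ) :
    Set (Set (Fin n → A) × Set (Fin n → A)) :=
  (fun p => (initialWords n p.1, initialWords n p.2)) '' coreVertices Y X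

/-- Removal of the last symbol from all words of a set. -/
def dropLast {n : ℕ} (C : Set (Fin (n + 1) → A)) : Set (Fin n → A) :=
  (fun v : Fin (n + 1) → A => Fin.init v) '' C

theorem dropLast_initialWords (n : ℕ) (C : Set (ℕ → A)) :
    dropLast (initialWords (n + 1) C) = initialWords n C := by
  simp only [dropLast, initialWords, image_image]
  rfl

theorem dropLast_mem_levelVertices [TopologicalSpace A] {Y X : Set (ℤ → A)} {n : ℕ}
    {c : Set (Fin (n + 1) → A) × Set (Fin (n + 1) → A)} (hc : c ∈ levelVertices Y X (n + 1)) :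
    (dropLast c.1, dropLast c.2) ∈ levelVertices Y X n := by
  obtain ⟨p, hp, rfl⟩ := hc
  exact ⟨p, hp, by simp only [dropLast_initialWords]⟩

/-- The λ-graph system `⋃ 𝒱_n(Y, X)`: edges act on both components, and `ι` removes the last symbol
from all words in both components. -/
noncomputable def pairSystem [Fintype A] [TopologicalSpace A] (Y X : Set (ℤ → A)) :
    LabeledBratteli.{u} where
  Alphabet := A
  V n := levelVertices Y X n
  fintypeV _ := Fintype.ofFinite _
  edge _ c a c' := WordEdge c.1.1 a c'.1.1 ∧ WordEdge c.1.2 a c'.1.2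
  ι _ c := ⟨(dropLast c.1.1, dropLast c.1.2), dropLast_mem_levelVertices c.2⟩

/-- The separation entropy of `Y` as a subsystem of `X`. -/
noncomputable def separationEntropy [Fintype A] [TopologicalSpace A] (Y X : Set (ℤ → A)) : EReal :=
  (pairSystem Y X).lambdaEntropy

end

end SubshiftPair

namespace SubshiftPair

open Set Function Topology Filter
open scoped ENNReal

/-! ### Initial words -/

section Words

variable {A : Type u}

/-! The proof factors the conjugacy into bipartite codes. Let `f : A → D × E`, `g : B → E × D` and
write `f (x i) = (d_i, e_i)`; the bipartite code sends `x` to the `y` with `g (y i) = (e_i,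
d_{i+1})`. Applied to those sequences of a vertex that begin with a fixed `d`, it gives the
operation `halfStep`. Two half steps compose to `τ_a` when `f a = (d, e)`
(`IsBipartite.halfStep_halfStep`), half steps commute with `τ` (`IsBipartite.dropSymbol_halfStep`),
and follower sets go to follower sets (`IsBipartite.exists_halfStep_followerSet`). Since the code
looks one symbol ahead, half steps descend to edges from level `n + 1` of one system to level `n` of
the other, and the 0-1 matrices of these edges satisfy all relations of a one-step equivalence
(`oneStepStrongShiftEquivalent_pairSystem`).

That the core has incoming edges is a compactness argument: closeness of vertices means equality of
long initial words (`mem_shannonVertices_iff`), and predecessors of a core vertex accumulate in the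
core (`exists_limit_predecessor`).

For a general conjugacy, both pairs are codings of the single `ℤ`-space `X` by finite observables,
the zeroth coordinates of `x` and of `φ x`. Adjoining a function of the next or previous value of an
observable is a bipartite code, so windows of coordinates can be enlarged and shrunk, and
observables that are block codes of each other are joined by a chain
(`IsBlockCode.observablesEquivalent`).

For the entropy, the relation `K K' = f(M I)` embeds level `n` of one system into the product of a
finite alphabet with level `n + 1` of the other (`card_le_of_oneStepRelations`), so the growth rates
agree. -/

theorem initialWords_subset_iff {n : ℕ} {C D : Set (ℕ → A)} :
    initialWords n C ⊆ initialWords n D ↔ ∀ r ∈ C, ∃ s ∈ D, ∀ i < n, s i = r i := by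
  constructor
  · intro h r hr
    obtain ⟨s, hs, e⟩ := h ⟨r, hr, rfl⟩
    exact ⟨s, hs, fun i hi => congrFun e ⟨i, hi⟩⟩
  · rintro h _ ⟨r, hr, rfl⟩
    obtain ⟨s, hs, e⟩ := h r hr
    exact ⟨s, hs, funext fun i => e i i.2⟩

theorem initialWords_mono {n : ℕ} {C D : Set (ℕ → A)} (h : C ⊆ D) :
    initialWords n C ⊆ initialWords n D := image_mono h

theorem initialWords_subset_of_le {m n : ℕ} (hmn : m ≤ n) {C D : Set (ℕ → A)}
    (h : initialWords n C ⊆ initialWords n D) : initialWords m C ⊆ initialWords m D := by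
  rw [initialWords_subset_iff] at h ⊢
  intro r hr
  obtain ⟨s, hs, e⟩ := h r hr
  exact ⟨s, hs, fun i hi => e i (hi.trans_le hmn)⟩

theorem initialWords_eq_of_le {m n : ℕ} (hmn : m ≤ n) {C D : Set (ℕ → A)}
    (h : initialWords n C = initialWords n D) : initialWords m C = initialWords m D :=
  (initialWords_subset_of_le hmn h.subset).antisymm (initialWords_subset_of_le hmn h.superset)

/-- Equality of initial words of `C` and `D` transfers sequences from `C` to `D`. -/
theorem exists_of_initialWords_eq {n : ℕ} {C D : Set (ℕ → A)}
    (h : initialWords n C = initialWords n D) {r : ℕ → A} (hr : r ∈ C) :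
    ∃ s ∈ D, ∀ i < n, s i = r i :=
  initialWords_subset_iff.1 h.subset r hr

/-- The set `τ_a(C)` of the sequences in `C` that begin with `a`, with that `a` removed. -/
def dropSymbol (a : A) (C : Set (ℕ → A)) : Set (ℕ → A) :=
  {s | ∃ r ∈ C, r 0 = a ∧ s = fun i => r (i + 1)}

theorem dropSymbol_mono {a : A} {C D : Set (ℕ → A)} (h : C ⊆ D) :
    dropSymbol a C ⊆ dropSymbol a D := by
  rintro _ ⟨r, hr, h0, rfl⟩
  exact ⟨r, h hr, h0, rfl⟩

theorem initialWords_dropSymbol_subset {n : ℕ} {C D : Set (ℕ → A)} (a : A)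
    (h : initialWords (n + 1) C ⊆ initialWords (n + 1) D) :
    initialWords n (dropSymbol a C) ⊆ initialWords n (dropSymbol a D) := by
  rw [initialWords_subset_iff] at h ⊢
  rintro _ ⟨r, hr, h0, rfl⟩
  obtain ⟨s, hs, e⟩ := h r hr
  exact ⟨_, ⟨s, hs, (e 0 n.succ_pos).trans h0, rfl⟩, fun i hi => e (i + 1) (by omega)⟩

theorem initialWords_dropSymbol_congr {n : ℕ} {C D : Set (ℕ → A)} (a : A)
    (h : initialWords (n + 1) C = initialWords (n + 1) D) :
    initialWords n (dropSymbol a C) = initialWords n (dropSymbol a D) :=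
  (initialWords_dropSymbol_subset a h.subset).antisymm
    (initialWords_dropSymbol_subset a h.superset)

theorem exists_head_iff_of_initialWords_eq {n : ℕ} {C D : Set (ℕ → A)} (P : A → Prop)
    (h : initialWords (n + 1) C = initialWords (n + 1) D) :
    (∃ r ∈ C, P (r 0)) ↔ ∃ r ∈ D, P (r 0) := by
  constructor
  · rintro ⟨r, hr, h0⟩
    obtain ⟨s, hs, e⟩ := exists_of_initialWords_eq h hr
    exact ⟨s, hs, by rwa [e 0 n.succ_pos]⟩
  · rintro ⟨r, hr, h0⟩
    obtain ⟨s, hs, e⟩ := exists_of_initialWords_eq h.symm hr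
    exact ⟨s, hs, by rwa [e 0 n.succ_pos]⟩

/-- Lets an edge between sets of words be computed on any set of sequences having those initial
words. -/
theorem wordEdge_initialWords_iff {n : ℕ} {C : Set (ℕ → A)} {a : A} {W : Set (Fin n → A)} :
    WordEdge (initialWords (n + 1) C) a W ↔
      (∃ r ∈ C, r 0 = a) ∧ W = initialWords n (dropSymbol a C) := by
  have h1 : (∃ v ∈ initialWords (n + 1) C, v 0 = a) ↔ ∃ r ∈ C, r 0 = a := by
    simp [initialWords]
  have h2 : {w | ∃ v ∈ initialWords (n + 1) C, v 0 = a ∧ w = Fin.tail v} =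
      initialWords n (dropSymbol a C) := by
    ext w
    constructor
    · rintro ⟨_, ⟨r, hr, rfl⟩, h0, rfl⟩
      exact ⟨_, ⟨r, hr, h0, rfl⟩, rfl⟩
    · rintro ⟨_, ⟨r, hr, h0, rfl⟩, rfl⟩
      exact ⟨_, ⟨r, hr, rfl⟩, h0, rfl⟩
  rw [WordEdge, h1, h2]

variable [TopologicalSpace A] [DiscreteTopology A]

theorem mem_of_isClosed_of_forall_prefix {C : Set (ℕ → A)} (hC : IsClosed C) {r : ℕ → A}
    (h : ∀ n, ∃ s ∈ C, ∀ i < n, s i = r i) : r ∈ C := by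
  rw [← hC.closure_eq, (PiNat.isTopologicalBasis_cylinders (fun _ : ℕ => A)).mem_closure_iff]
  rintro _ ⟨x, n, rfl⟩ hr
  obtain ⟨s, hs, e⟩ := h n
  exact ⟨s, fun i hi => (e i hi).trans (hr i hi), hs⟩

theorem isClosed_of_forall_prefix {C : Set (ℕ → A)}
    (h : ∀ r, (∀ n, ∃ s ∈ C, ∀ i < n, s i = r i) → r ∈ C) : IsClosed C := by
  refine isClosed_of_closure_subset fun r hr => h r fun n => ?_
  obtain ⟨s, hs, hsC⟩ := mem_closure_iff.1 hr _
    (PiNat.isOpen_cylinder (fun _ : ℕ => A) r n) (PiNat.self_mem_cylinder r n)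
  exact ⟨s, hsC, hs⟩

theorem subset_of_initialWords_subset {C D : Set (ℕ → A)} (hD : IsClosed D)
    (h : ∀ n, initialWords n C ⊆ initialWords n D) : C ⊆ D := fun r hr =>
  mem_of_isClosed_of_forall_prefix hD fun n => initialWords_subset_iff.1 (h n) r hr

theorem eq_of_initialWords_eq {C D : Set (ℕ → A)} (hC : IsClosed C) (hD : IsClosed D)
    (h : ∀ n, initialWords n C = initialWords n D) : C = D :=
  (subset_of_initialWords_subset hD fun n => (h n).subset).antisymm
    (subset_of_initialWords_subset hC fun n => (h n).superset)

theorem isClosed_dropSymbol {C : Set (ℕ → A)} (hC : IsClosed C) (a : A) :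
    IsClosed (dropSymbol a C) := by
  refine isClosed_of_forall_prefix fun r hr => ?_
  refine ⟨fun i => Nat.casesOn i a r, ?_, rfl, rfl⟩
  refine mem_of_isClosed_of_forall_prefix hC fun n => ?_
  obtain ⟨_, ⟨s, hs, h0, rfl⟩, e⟩ := hr n
  refine ⟨s, hs, fun i hi => ?_⟩
  cases i with
  | zero => exact h0
  | succ i => exact e i (by omega)

/-! ### The Vietoris topology in terms of initial words -/

/-- Having the same words as `C` means lying in the open union of their cylinders and meeting each
of these finitely many open cylinders: both are subbasic conditions. -/
theorem isOpen_setOf_initialWords_eq [Finite A] (n : ℕ) (C : Set (ℕ → A)) :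
    IsOpen[TopologicalSpace.vietoris (ℕ → A)] {D | initialWords n D = initialWords n C} := by
  let _ := TopologicalSpace.vietoris (ℕ → A)
  have hcont : Continuous fun (r : ℕ → A) (i : Fin n) => r i := by fun_prop
  have hpre (S : Set (Fin n → A)) : IsOpen ((fun (r : ℕ → A) (i : Fin n) => r i) ⁻¹' S) :=
    (isOpen_discrete S).preimage hcont
  have heq : {D : Set (ℕ → A) | initialWords n D = initialWords n C} =
      𝒫 ((fun (r : ℕ → A) (i : Fin n) => r i) ⁻¹' initialWords n C) ∩
        ⋂ w ∈ initialWords n C,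
          {D | (D ∩ (fun (r : ℕ → A) (i : Fin n) => r i) ⁻¹' {w}).Nonempty} := by
    ext D
    simp only [mem_ofPred_eq, mem_inter_iff, mem_powerset_iff, mem_iInter, subset_antisymm_iff]
    refine and_congr image_subset_iff ⟨fun h w hw => ?_, fun h w hw => ?_⟩
    · obtain ⟨r, hr, e⟩ := h hw
      exact ⟨r, hr, e⟩
    · obtain ⟨r, hr, e⟩ := h w hw
      exact ⟨r, hr, e⟩
  rw [heq]
  exact (hpre _).powerset_vietoris.inter ((toFinite _).isOpen_biInter fun w _ =>
    TopologicalSpace.vietoris.isOpen_inter_nonempty_of_isOpen (hpre _))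

theorem exists_initialWords_of_isOpen [Finite A] {O : Set (Set (ℕ → A))}
    (hO : IsOpen[TopologicalSpace.vietoris (ℕ → A)] O) {C : Set (ℕ → A)} (hC : IsClosed C)
    (hCO : C ∈ O) : ∃ n, ∀ D, initialWords n D = initialWords n C → D ∈ O := by
  induction hO with
  | univ => exact ⟨0, fun D _ => mem_univ D⟩
  | inter S T _ _ hS hT =>
    obtain ⟨m, hm⟩ := hS hCO.1
    obtain ⟨n, hn⟩ := hT hCO.2
    exact ⟨max m n, fun D hD => ⟨hm D (initialWords_eq_of_le (le_max_left _ _) hD),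
      hn D (initialWords_eq_of_le (le_max_right _ _) hD)⟩⟩
  | sUnion 𝒮 _ ih =>
    obtain ⟨S, hS, hCS⟩ := hCO
    obtain ⟨n, hn⟩ := ih S hS hCS
    exact ⟨n, fun D hD => ⟨S, hS, hn D hD⟩⟩
  | basic S hS =>
    rcases hS with ⟨U, hU, rfl⟩ | ⟨U, hU, rfl⟩
    -- Compactness of `C` makes one length `n` work at all its points: every cylinder of length `n`
    -- around a point of `C` lies in `U`.
    · obtain ⟨n, hn⟩ := hC.isCompact.elim_directed_cover
        (fun n : ℕ => {r | PiNat.cylinder r n ⊆ U})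
        (fun n => by
          rw [isOpen_iff_forall_mem_open]
          refine fun r hr => ⟨PiNat.cylinder r n, fun s hs => ?_,
            PiNat.isOpen_cylinder _ r n, PiNat.self_mem_cylinder r n⟩
          rwa [mem_ofPred_eq, PiNat.mem_cylinder_iff_eq.1 hs])
        (fun r hr => by
          obtain ⟨_, ⟨x, n, rfl⟩, hx, hxU⟩ := (PiNat.isTopologicalBasis_cylinders
            (fun _ : ℕ => A)).exists_subset_of_mem_open (hCO hr) hU
          exact mem_iUnion.2 ⟨n, by rwa [mem_ofPred_eq, PiNat.mem_cylinder_iff_eq.1 hx]⟩)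
        (directed_of_isDirected_le fun m n hmn r hr =>
          (PiNat.cylinder_anti r hmn).trans hr)
      refine ⟨n, fun D hD r hr => ?_⟩
      obtain ⟨s, hs, e⟩ := exists_of_initialWords_eq hD hr
      exact hn hs fun i hi => (e i hi).symm
    · obtain ⟨r, hr, hrU⟩ := hCO
      obtain ⟨_, ⟨x, n, rfl⟩, hx, hxU⟩ := (PiNat.isTopologicalBasis_cylinders
        (fun _ : ℕ => A)).exists_subset_of_mem_open hrU hU
      refine ⟨n, fun D hD => ?_⟩
      obtain ⟨s, hs, e⟩ := exists_of_initialWords_eq hD.symm hr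
      exact ⟨s, hs, hxU fun i hi => (e i hi).trans (hx i hi)⟩

theorem mem_shannonVertices_iff [Finite A] {X : Set (ℤ → A)} {C : Set (ℕ → A)} :
    C ∈ shannonVertices X ↔
      IsClosed C ∧ ∀ n, ∃ x ∈ X, initialWords n C = initialWords n (followerSet X x) := by
  let _ := TopologicalSpace.vietoris (ℕ → A)
  refine and_congr_right fun hC => ?_
  rw [mem_closure_iff]
  constructor
  · intro h n
    obtain ⟨_, hD, x, hx, rfl⟩ := h _ (isOpen_setOf_initialWords_eq n C) rfl
    exact ⟨x, hx, hD.symm⟩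
  · intro h O hO hCO
    obtain ⟨n, hn⟩ := exists_initialWords_of_isOpen hO hC hCO
    obtain ⟨x, hx, e⟩ := h n
    exact ⟨_, hn _ e.symm, x, hx, rfl⟩

end Words

section Limits

variable {A : Type u}

/-! ### Limits along an ultrafilter -/

/-- In each coordinate the ultrafilter selects one of the finitely many symbols. -/
theorem exists_limit_of_sequences [Finite A] (𝒰 : Ultrafilter ℕ) (r : ℕ → ℕ → A) :
    ∃ s : ℕ → A, ∀ k, ∀ᶠ n in 𝒰, ∀ i < k, s i = r n i := by
  have h (i : ℕ) : ∃ a, ∀ᶠ n in 𝒰, a = r n i := by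
    rw [← Ultrafilter.eventually_exists_iff]
    exact Eventually.of_forall fun n => ⟨_, rfl⟩
  choose s hs using h
  exact ⟨s, fun k => (eventually_all_finite (finite_lt_nat k)).2 fun i _ => hs i⟩

variable [TopologicalSpace A] [DiscreteTopology A]

/-- Compactness of the hyperspace in terms of words. The limit consists of the sequences each of
whose prefixes occurs in `C n` for almost all `n`. -/
theorem exists_limit_of_sets [Finite A] (𝒰 : Ultrafilter ℕ) (C : ℕ → Set (ℕ → A)) :
    ∃ L, IsClosed L ∧ ∀ k, ∀ᶠ n in 𝒰, initialWords k L = initialWords k (C n) := by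
  refine ⟨{r | ∀ k, ∀ᶠ n in 𝒰, ∃ s ∈ C n, ∀ i < k, s i = r i}, ?_, fun k => ?_⟩
  · refine isClosed_of_forall_prefix fun r hr k => ?_
    obtain ⟨t, ht, e⟩ := hr k
    filter_upwards [ht k] with n ⟨s, hs, e'⟩
    exact ⟨s, hs, fun i hi => (e' i hi).trans (e i hi)⟩
  · simp only [subset_antisymm_iff]
    refine Eventually.and ?_ ?_
    · refine (eventually_all_finite (toFinite _)).2 ?_
      rintro _ ⟨r, hr, rfl⟩
      filter_upwards [hr k] with n ⟨s, hs, e⟩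
      exact ⟨s, hs, funext fun i => e i i.2⟩
    -- If almost every `C n` had a word of length `k` missing from the limit, sequences witnessing
    -- this would themselves converge to a member of the limit that has such a word.
    · by_contra hcon
      rw [← Ultrafilter.eventually_not] at hcon
      -- An implication, because a sequence has to be chosen for every `n`, including the
      -- exceptional ones.
      have h (n : ℕ) : ∃ r : ℕ → A, ¬ initialWords k (C n) ⊆ initialWords k
          {r | ∀ k, ∀ᶠ n in 𝒰, ∃ s ∈ C n, ∀ i < k, s i = r i} →
          r ∈ C n ∧ (fun i : Fin k => r i) ∉ initialWords k
          {r | ∀ k, ∀ᶠ n in 𝒰, ∃ s ∈ C n, ∀ i < k, s i = r i} := by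
        by_cases hn : initialWords k (C n) ⊆ initialWords k
          {r | ∀ k, ∀ᶠ n in 𝒰, ∃ s ∈ C n, ∀ i < k, s i = r i}
        · obtain ⟨m, hm⟩ := hcon.exists
          obtain ⟨_, ⟨r, -, -⟩, -⟩ := not_subset.1 hm
          exact ⟨r, fun h => absurd hn h⟩
        · obtain ⟨_, ⟨r, hr, rfl⟩, hw⟩ := not_subset.1 hn
          exact ⟨r, fun _ => ⟨hr, hw⟩⟩
      choose r hr using h
      obtain ⟨s, hs⟩ := exists_limit_of_sequences 𝒰 r
      have hsL : s ∈ {r | ∀ k, ∀ᶠ n in 𝒰, ∃ s ∈ C n, ∀ i < k, s i = r i} := fun j => by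
        filter_upwards [hs j, hcon] with n h1 h2
        exact ⟨r n, (hr n h2).1, fun i hi => (h1 i hi).symm⟩
      obtain ⟨n, h1, h2⟩ := ((hs k).and hcon).exists
      exact (hr n h2).2 ⟨s, hsL, funext fun i => h1 i i.2⟩

end Limits

section Core

variable {A : Type u}

/-! ### Follower sets and edges of the Shannon graph -/

/-- Invariance under all powers of the shift. -/
def ShiftInvariant (X : Set (ℤ → A)) : Prop :=
  ∀ k : ℤ, ∀ x ∈ X, (fun i => x (i + k)) ∈ X

theorem followerSet_congr {X : Set (ℤ → A)} {x z : ℤ → A} (h : ∀ i ≤ 0, x i = z i) :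
    followerSet X x = followerSet X z := by
  ext r
  refine exists_congr fun w => and_congr_right fun _ => and_congr_left fun _ =>
    forall₂_congr fun i hi => by rw [h i hi]

theorem dropSymbol_followerSet {X : Set (ℤ → A)} (hX : ShiftInvariant X) (x : ℤ → A) :
    dropSymbol (x 1) (followerSet X x) = followerSet X fun i => x (i + 1) := by
  ext s
  constructor
  · rintro ⟨r, ⟨z, hz, hzx, hzr⟩, h0, rfl⟩
    refine ⟨_, hX 1 z hz, fun i hi => ?_, fun i => by simpa using hzr (i + 1)⟩
    rcases hi.lt_or_eq with hi | rfl
    · exact hzx (i + 1) (by omega)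
    · simpa [h0] using hzr 0
  · rintro ⟨z, hz, hzx, hzs⟩
    refine ⟨fun i => z i, ⟨_, hX (-1) z hz, fun i hi => ?_, fun i => by simp⟩, ?_, ?_⟩
    · simpa using hzx (i + -1) (by omega)
    · simpa using hzx 0 le_rfl
    · funext i
      simpa using (hzs i).symm

theorem self_mem_followerSet {X : Set (ℤ → A)} {x : ℤ → A} (hx : x ∈ X) :
    (fun i : ℕ => x (i + 1)) ∈ followerSet X x :=
  ⟨x, hx, fun _ _ => rfl, fun _ => rfl⟩

/-- A sequence in `Γ⁺(x⁻)` is the positive half of a point with the same negative half. -/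
theorem exists_of_mem_followerSet {X : Set (ℤ → A)} {x : ℤ → A} {r : ℕ → A}
    (hr : r ∈ followerSet X x) :
    ∃ z ∈ X, followerSet X z = followerSet X x ∧ ∀ i : ℕ, z (i + 1) = r i := by
  obtain ⟨z, hz, hzx, hzr⟩ := hr
  exact ⟨z, hz, followerSet_congr hzx, hzr⟩

/-! ### The pair Shannon graph -/

/-- The final vertex of the edge labeled `a` that leaves a pair. -/
def dropPair (a : A) (p : Set (ℕ → A) × Set (ℕ → A)) : Set (ℕ → A) × Set (ℕ → A) :=
  (dropSymbol a p.1, dropSymbol a p.2)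

/-- The initial words of a pair. -/
def pairWords (n : ℕ) (p : Set (ℕ → A) × Set (ℕ → A)) : Set (Fin n → A) × Set (Fin n → A) :=
  (initialWords n p.1, initialWords n p.2)

theorem pairWords_eq_of_le {m n : ℕ} (hmn : m ≤ n) {p q : Set (ℕ → A) × Set (ℕ → A)}
    (h : pairWords n p = pairWords n q) : pairWords m p = pairWords m q :=
  Prod.ext (initialWords_eq_of_le hmn (congrArg Prod.fst h))
    (initialWords_eq_of_le hmn (congrArg Prod.snd h))

theorem pairWords_dropPair_congr {n : ℕ} {p q : Set (ℕ → A) × Set (ℕ → A)} (a : A)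
    (h : pairWords (n + 1) p = pairWords (n + 1) q) :
    pairWords n (dropPair a p) = pairWords n (dropPair a q) :=
  Prod.ext (initialWords_dropSymbol_congr a (congrArg Prod.fst h))
    (initialWords_dropSymbol_congr a (congrArg Prod.snd h))

theorem pairSuccessors_mono {S T : Set (Set (ℕ → A) × Set (ℕ → A))} (h : S ⊆ T) :
    pairSuccessors S ⊆ pairSuccessors T := by
  rintro q ⟨p, hp, a, e⟩
  exact ⟨p, h hp, a, e⟩

variable [TopologicalSpace A] {Y X : Set (ℤ → A)}

/-- Since `p.1 ⊆ p.2`, a label available in the first component is available in the second. -/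
theorem mem_pairSuccessors_iff {S : Set (Set (ℕ → A) × Set (ℕ → A))} (hS : S ⊆ pairVertices Y X)
    {q : Set (ℕ → A) × Set (ℕ → A)} :
    q ∈ pairSuccessors S ↔ ∃ p ∈ S, ∃ a, (∃ r ∈ p.1, r 0 = a) ∧ q = dropPair a p := by
  constructor
  · rintro ⟨p, hp, a, h1, h2⟩
    exact ⟨p, hp, a, h1.1, Prod.ext h1.2 h2.2⟩
  · rintro ⟨p, hp, a, ⟨r, hr, h0⟩, rfl⟩
    exact ⟨p, hp, a, ⟨⟨r, hr, h0⟩, rfl⟩, ⟨r, (hS hp).2.2 hr, h0⟩, rfl⟩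

variable [DiscreteTopology A] [Finite A]

/-- The words of length `0` already detect emptiness. -/
theorem nonempty_of_mem_shannonVertices {C : Set (ℕ → A)}
    (hC : C ∈ shannonVertices X) : C.Nonempty := by
  obtain ⟨x, hx, e⟩ := (mem_shannonVertices_iff.1 hC).2 0
  obtain ⟨s, hs, -⟩ := exists_of_initialWords_eq e.symm (self_mem_followerSet hx)
  exact ⟨s, hs⟩

/-- The initial words of a vertex with a sequence satisfying `P` at its first symbol are those of
`Γ⁺(x⁻)` for a point whose first symbol satisfies `P`. -/
theorem exists_followerSet_of_mem_shannonVertices {C : Set (ℕ → A)}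
    (hC : C ∈ shannonVertices X) {P : A → Prop} (hP : ∃ r ∈ C, P (r 0)) (n : ℕ) :
    ∃ x ∈ X, P (x 1) ∧ initialWords (n + 1) C = initialWords (n + 1) (followerSet X x) := by
  obtain ⟨x, hx, e⟩ := (mem_shannonVertices_iff.1 hC).2 (n + 1)
  obtain ⟨r, hr, h0⟩ := (exists_head_iff_of_initialWords_eq P e).1 hP
  obtain ⟨z, hz, hzx, hzr⟩ := exists_of_mem_followerSet hr
  refine ⟨z, hz, ?_, by rw [hzx, e]⟩
  rw [← hzr 0] at h0
  simpa using h0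

theorem dropSymbol_mem_shannonVertices (hX : ShiftInvariant X)
    {C : Set (ℕ → A)} (hC : C ∈ shannonVertices X) {a : A} (ha : ∃ r ∈ C, r 0 = a) :
    dropSymbol a C ∈ shannonVertices X := by
  rw [mem_shannonVertices_iff]
  refine ⟨isClosed_dropSymbol hC.1 a, fun n => ?_⟩
  obtain ⟨x, hx, rfl, e⟩ :=
    exists_followerSet_of_mem_shannonVertices hC (P := fun b => b = a) ha n
  exact ⟨_, hX 1 x hx, by rw [← dropSymbol_followerSet hX, initialWords_dropSymbol_congr _ e]⟩

/-! ### The core of the pair Shannon graph -/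

theorem dropPair_mem_pairVertices (hY : ShiftInvariant Y) (hX : ShiftInvariant X)
    {p : Set (ℕ → A) × Set (ℕ → A)} (hp : p ∈ pairVertices Y X) {a : A}
    (ha : ∃ r ∈ p.1, r 0 = a) : dropPair a p ∈ pairVertices Y X := by
  obtain ⟨h1, h2, h3⟩ := hp
  refine ⟨dropSymbol_mem_shannonVertices hY h1 ha, dropSymbol_mem_shannonVertices hX h2 ?_,
    dropSymbol_mono h3⟩
  obtain ⟨r, hr, h0⟩ := ha
  exact ⟨r, h3 hr, h0⟩

theorem pairSuccessors_pairVertices_subset (hY : ShiftInvariant Y) (hX : ShiftInvariant X) :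
    pairSuccessors (pairVertices Y X) ⊆ pairVertices Y X := by
  intro q hq
  obtain ⟨p, hp, a, ha, rfl⟩ := (mem_pairSuccessors_iff subset_rfl).1 hq
  exact dropPair_mem_pairVertices hY hX hp ha

theorem pairSuccessors_iterate_succ_subset (hY : ShiftInvariant Y) (hX : ShiftInvariant X)
    (n : ℕ) :
    pairSuccessors^[n + 1] (pairVertices Y X) ⊆ pairSuccessors^[n] (pairVertices Y X) := by
  induction n with
  | zero => exact pairSuccessors_pairVertices_subset hY hX
  | succ n ih =>
    rw [iterate_succ_apply', iterate_succ_apply']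
    exact pairSuccessors_mono (by simpa only [iterate_succ_apply'] using ih)

theorem pairSuccessors_iterate_antitone (hY : ShiftInvariant Y) (hX : ShiftInvariant X) :
    Antitone fun n => pairSuccessors^[n] (pairVertices Y X) :=
  antitone_nat_of_succ_le (pairSuccessors_iterate_succ_subset hY hX)

theorem pairSuccessors_iterate_subset (hY : ShiftInvariant Y) (hX : ShiftInvariant X) (n : ℕ) :
    pairSuccessors^[n] (pairVertices Y X) ⊆ pairVertices Y X :=
  pairSuccessors_iterate_antitone hY hX n.zero_le

theorem mem_coreVertices_iff (hY : ShiftInvariant Y) (hX : ShiftInvariant X)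
    {p : Set (ℕ → A) × Set (ℕ → A)} :
    p ∈ coreVertices Y X ↔ ∀ n, p ∈ pairSuccessors^[n] (pairVertices Y X) := by
  rw [coreVertices, mem_iInter]
  exact ⟨fun h n => pairSuccessors_iterate_succ_subset hY hX n (h n), fun h n => h (n + 1)⟩

theorem coreVertices_subset (hY : ShiftInvariant Y) (hX : ShiftInvariant X) :
    coreVertices Y X ⊆ pairVertices Y X := fun _ hp => (mem_coreVertices_iff hY hX).1 hp 0

theorem dropPair_mem_coreVertices (hY : ShiftInvariant Y) (hX : ShiftInvariant X)
    {p : Set (ℕ → A) × Set (ℕ → A)} (hp : p ∈ coreVertices Y X) {a : A}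
    (ha : ∃ r ∈ p.1, r 0 = a) : dropPair a p ∈ coreVertices Y X := by
  rw [coreVertices, mem_iInter]
  intro n
  rw [iterate_succ_apply', mem_pairSuccessors_iff (pairSuccessors_iterate_subset hY hX n)]
  exact ⟨p, (mem_coreVertices_iff hY hX).1 hp n, a, ha, rfl⟩

/-- A set of pairs that contains every pair of closed sets all of whose pairs of initial words come
from the set. -/
def PrefixClosed (S : Set (Set (ℕ → A) × Set (ℕ → A))) : Prop :=
  ∀ p : Set (ℕ → A) × Set (ℕ → A), IsClosed p.1 → IsClosed p.2 →
    (∀ n, ∃ q ∈ S, pairWords n p = pairWords n q) → p ∈ S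

theorem prefixClosed_pairVertices : PrefixClosed (pairVertices Y X) := by
  intro p h1 h2 h
  refine ⟨mem_shannonVertices_iff.2 ⟨h1, fun n => ?_⟩, mem_shannonVertices_iff.2 ⟨h2, fun n => ?_⟩,
    subset_of_initialWords_subset h2 fun n => ?_⟩
  · obtain ⟨q, hq, e⟩ := h n
    obtain ⟨x, hx, e'⟩ := (mem_shannonVertices_iff.1 hq.1).2 n
    exact ⟨x, hx, (congrArg Prod.fst e).trans e'⟩
  · obtain ⟨q, hq, e⟩ := h n
    obtain ⟨x, hx, e'⟩ := (mem_shannonVertices_iff.1 hq.2.1).2 n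
    exact ⟨x, hx, (congrArg Prod.snd e).trans e'⟩
  · obtain ⟨q, hq, e⟩ := h n
    rw [show initialWords n p.1 = initialWords n q.1 from congrArg Prod.fst e,
      show initialWords n p.2 = initialWords n q.2 from congrArg Prod.snd e]
    exact initialWords_mono hq.2.2

/-- Predecessors of approximations of `p` accumulate at a predecessor of `p`. -/
theorem exists_limit_predecessor {p : Set (ℕ → A) × Set (ℕ → A)} (h1 : IsClosed p.1)
    (h2 : IsClosed p.2) (q : ℕ → Set (ℕ → A) × Set (ℕ → A)) (a : ℕ → A)
    (ha : ∀ n, ∃ r ∈ (q n).1, r 0 = a n)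
    (hq : ∀ n, pairWords n p = pairWords n (dropPair (a n) (q n))) :
    ∃ l : Set (ℕ → A) × Set (ℕ → A), ∃ b, IsClosed l.1 ∧ IsClosed l.2 ∧ (∃ r ∈ l.1, r 0 = b) ∧
      p = dropPair b l ∧ ∀ k m, ∃ n ≥ m, pairWords k l = pairWords k (q n) := by
  obtain ⟨l₁, hl₁, e₁⟩ := exists_limit_of_sets (hyperfilter ℕ) fun n => (q n).1
  obtain ⟨l₂, hl₂, e₂⟩ := exists_limit_of_sets (hyperfilter ℕ) fun n => (q n).2
  have he (k : ℕ) : ∀ᶠ n in hyperfilter ℕ, pairWords k (l₁, l₂) = pairWords k (q n) := by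
    filter_upwards [e₁ k, e₂ k] with n h1 h2 using Prod.ext h1 h2
  obtain ⟨b, hb⟩ : ∃ b, ∀ᶠ n in hyperfilter ℕ, b = a n := by
    rw [← Ultrafilter.eventually_exists_iff]
    exact Eventually.of_forall fun n => ⟨_, rfl⟩
  have hlarge (m : ℕ) : ∀ᶠ n in hyperfilter ℕ, m ≤ n :=
    Nat.hyperfilter_le_atTop (eventually_ge_atTop m)
  have hp (k : ℕ) : pairWords k p = pairWords k (dropPair b (l₁, l₂)) := by
    -- `hq n` controls words of length `n` only, hence the demand `k ≤ n`; the length `k + 1` allows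
    -- for the symbol dropped.
    obtain ⟨n, hn, rfl, hkn⟩ := ((he (k + 1)).and (hb.and (hlarge k))).exists
    rw [pairWords_dropPair_congr _ hn, pairWords_eq_of_le hkn (hq n)]
  refine ⟨(l₁, l₂), b, hl₁, hl₂, ?_, Prod.ext ?_ ?_, fun k m => ?_⟩
  · obtain ⟨n, hn, rfl⟩ := ((he 1).and hb).exists
    exact (exists_head_iff_of_initialWords_eq (fun c => c = a n) (congrArg Prod.fst hn)).2 (ha n)
  · exact eq_of_initialWords_eq h1 (isClosed_dropSymbol hl₁ b) fun k => congrArg Prod.fst (hp k)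
  · exact eq_of_initialWords_eq h2 (isClosed_dropSymbol hl₂ b) fun k => congrArg Prod.snd (hp k)
  · obtain ⟨n, hn, hmn⟩ := ((he k).and (hlarge m)).exists
    exact ⟨n, hmn, hn⟩

/-- The image of a compact set is closed: chosen predecessors of the approximations have a limit in
`S`. -/
theorem PrefixClosed.pairSuccessors {S : Set (Set (ℕ → A) × Set (ℕ → A))} (hS : PrefixClosed S)
    (hSP : S ⊆ pairVertices Y X) : PrefixClosed (pairSuccessors S) := by
  intro p h1 h2 h
  have h' (n : ℕ) : ∃ q ∈ S, ∃ a, (∃ r ∈ q.1, r 0 = a) ∧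
      pairWords n p = pairWords n (dropPair a q) := by
    obtain ⟨_, hq, e⟩ := h n
    obtain ⟨q, hqS, a, ha, rfl⟩ := (mem_pairSuccessors_iff hSP).1 hq
    exact ⟨q, hqS, a, ha, e⟩
  choose q hqS a ha e using h'
  obtain ⟨l, b, hl₁, hl₂, hb, hpl, hl⟩ := exists_limit_predecessor h1 h2 q a ha e
  refine (mem_pairSuccessors_iff hSP).2 ⟨l, hS l hl₁ hl₂ fun k => ?_, b, hb, hpl⟩
  obtain ⟨n, -, hn⟩ := hl k 0
  exact ⟨_, hqS n, hn⟩

theorem prefixClosed_pairSuccessors_iterate (hY : ShiftInvariant Y) (hX : ShiftInvariant X)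
    (n : ℕ) : PrefixClosed (SubshiftPair.pairSuccessors^[n] (pairVertices Y X)) := by
  induction n with
  | zero => exact prefixClosed_pairVertices
  | succ n ih =>
    rw [iterate_succ_apply']
    exact ih.pairSuccessors (pairSuccessors_iterate_subset hY hX n)

/-- Every vertex of the core has a predecessor in the core. -/
theorem exists_predecessor_mem_coreVertices (hY : ShiftInvariant Y) (hX : ShiftInvariant X)
    {p : Set (ℕ → A) × Set (ℕ → A)} (hp : p ∈ coreVertices Y X) :
    ∃ q ∈ coreVertices Y X, ∃ a, (∃ r ∈ q.1, r 0 = a) ∧ p = dropPair a q := by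
  have h (n : ℕ) : ∃ q ∈ SubshiftPair.pairSuccessors^[n] (pairVertices Y X),
      ∃ a, (∃ r ∈ q.1, r 0 = a) ∧ p = dropPair a q := by
    have := (mem_coreVertices_iff hY hX).1 hp (n + 1)
    rwa [iterate_succ_apply', mem_pairSuccessors_iff (pairSuccessors_iterate_subset hY hX n)]
      at this
  choose q hq a ha e using h
  have hpP := coreVertices_subset hY hX hp
  obtain ⟨l, b, hl₁, hl₂, hb, hpl, hl⟩ := exists_limit_predecessor hpP.1.1 hpP.2.1.1 q a ha
    fun n => congrArg (pairWords n) (e n)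
  -- The iterates decrease, so the `m`-th one contains `q n` for all `n ≥ m`; being prefix closed,
  -- it also contains the limit `l`.
  refine ⟨l, (mem_coreVertices_iff hY hX).2 fun m => ?_, b, hb, hpl⟩
  refine prefixClosed_pairSuccessors_iterate hY hX m l hl₁ hl₂ fun k => ?_
  obtain ⟨n, hmn, hn⟩ := hl k m
  exact ⟨q n, pairSuccessors_iterate_antitone hY hX hmn (hq n), hn⟩

end Core

section PairSystem

variable {A : Type u} [TopologicalSpace A] {Y X : Set (ℤ → A)}

/-! ### The λ-graph system of a pair of subshifts -/

/-- The vertex of level `n` given by a vertex of the core. -/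
def levelVertex (n : ℕ) (p : Set (ℕ → A) × Set (ℕ → A)) (hp : p ∈ coreVertices Y X) :
    levelVertices Y X n :=
  ⟨pairWords n p, p, hp, rfl⟩

theorem exists_eq_levelVertex {n : ℕ} (c : levelVertices Y X n) :
    ∃ p, ∃ hp : p ∈ coreVertices Y X, c = levelVertex n p hp := by
  obtain ⟨_, p, hp, rfl⟩ := c
  exact ⟨p, hp, rfl⟩

theorem eq_levelVertex_iff {n : ℕ} {c : levelVertices Y X n} {p : Set (ℕ → A) × Set (ℕ → A)}
    {hp : p ∈ coreVertices Y X} : c = levelVertex n p hp ↔ c.1 = pairWords n p :=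
  Subtype.ext_iff

variable [Fintype A]

theorem pairSystem_ι_levelVertex (n : ℕ) {p : Set (ℕ → A) × Set (ℕ → A)}
    (hp : p ∈ coreVertices Y X) :
    (pairSystem Y X).ι n (levelVertex (n + 1) p hp) = levelVertex n p hp :=
  Subtype.ext (Prod.ext (dropLast_initialWords n p.1) (dropLast_initialWords n p.2))

variable [DiscreteTopology A]

theorem pairSystem_edge_iff (hY : ShiftInvariant Y) (hX : ShiftInvariant X) {n : ℕ}
    {p : Set (ℕ → A) × Set (ℕ → A)} (hp : p ∈ coreVertices Y X) {a : A}
    {c : levelVertices Y X n} :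
    (pairSystem Y X).edge n (levelVertex (n + 1) p hp) a c ↔
      (∃ r ∈ p.1, r 0 = a) ∧ c.1 = pairWords n (dropPair a p) := by
  change WordEdge (initialWords (n + 1) p.1) a c.1.1 ∧
    WordEdge (initialWords (n + 1) p.2) a c.1.2 ↔ _
  rw [wordEdge_initialWords_iff, wordEdge_initialWords_iff]
  constructor
  · rintro ⟨⟨h, e1⟩, -, e2⟩
    exact ⟨h, Prod.ext e1 e2⟩
  · rintro ⟨⟨r, hr, h0⟩, e⟩
    exact ⟨⟨⟨r, hr, h0⟩, congrArg Prod.fst e⟩,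
      ⟨r, (coreVertices_subset hY hX hp).2.2 hr, h0⟩, congrArg Prod.snd e⟩

theorem pairSystem_exists_edge_iff (hY : ShiftInvariant Y) (hX : ShiftInvariant X) {n : ℕ}
    {p : Set (ℕ → A) × Set (ℕ → A)} (hp : p ∈ coreVertices Y X) {a : A}
    {P : levelVertices Y X n → Prop} :
    (∃ c, (pairSystem Y X).edge n (levelVertex (n + 1) p hp) a c ∧ P c) ↔
      ∃ ha : ∃ r ∈ p.1, r 0 = a,
        P (levelVertex n (dropPair a p) (dropPair_mem_coreVertices hY hX hp ha)) := by
  constructor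
  · rintro ⟨c, hc, hP⟩
    obtain ⟨ha, e⟩ := (pairSystem_edge_iff hY hX hp).1 hc
    refine ⟨ha, ?_⟩
    rwa [← (eq_levelVertex_iff (c := c)).2 e]
  · rintro ⟨ha, hP⟩
    exact ⟨_, (pairSystem_edge_iff hY hX hp).2 ⟨ha, rfl⟩, hP⟩

/-- Everything is read off from representatives in the core. Outgoing edges exist because vertices
are nonempty, incoming ones because core vertices have core predecessors. -/
theorem isLambdaGraphSystem_pairSystem (hY : ShiftInvariant Y) (hX : ShiftInvariant X) :
    (pairSystem Y X).IsLambdaGraphSystem where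
  right_resolving n c a c' c'' h h' :=
    Subtype.ext (Prod.ext (h.1.2.trans h'.1.2.symm) (h.2.2.trans h'.2.2.symm))
  exists_outgoing n c := by
    obtain ⟨p, hp, rfl⟩ := exists_eq_levelVertex c
    obtain ⟨r, hr⟩ := nonempty_of_mem_shannonVertices (coreVertices_subset hY hX hp).1
    exact ⟨r 0, levelVertex n _ (dropPair_mem_coreVertices hY hX hp ⟨r, hr, rfl⟩),
      (pairSystem_edge_iff hY hX hp).2 ⟨⟨r, hr, rfl⟩, rfl⟩⟩
  exists_incoming n c := by
    obtain ⟨p, hp, rfl⟩ := exists_eq_levelVertex c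
    obtain ⟨q, hq, a, ha, rfl⟩ := exists_predecessor_mem_coreVertices hY hX hp
    exact ⟨levelVertex (n + 1) q hq, a, (pairSystem_edge_iff hY hX hq).2 ⟨ha, rfl⟩⟩
  ι_surjective n c := by
    obtain ⟨p, hp, rfl⟩ := exists_eq_levelVertex c
    exact ⟨levelVertex (n + 1) p hp, pairSystem_ι_levelVertex n hp⟩
  compatible n c a c' := by
    obtain ⟨p, hp, rfl⟩ := exists_eq_levelVertex c
    rw [pairSystem_ι_levelVertex]
    refine (pairSystem_exists_edge_iff hY hX hp (a := a)
      (P := fun d => (pairSystem Y X).ι n d = c')).trans ?_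
    refine Iff.trans ?_ (pairSystem_edge_iff hY hX hp (c := c')).symm
    rw [← exists_prop]
    refine exists_congr fun ha => ?_
    rw [pairSystem_ι_levelVertex]
    exact eq_comm.trans eq_levelVertex_iff

end PairSystem

section Bipartite

variable {A B D E : Type u} {f : A → D × E} {g : B → E × D} {X : Set (ℤ → A)} {X' : Set (ℤ → B)}

/-! ### Bipartite codes -/

/-- `X` and `X'` are shift-invariant and conjugate by the bipartite code given by `f` and `g`. -/
structure IsBipartite (f : A → D × E) (g : B → E × D) (X : Set (ℤ → A)) (X' : Set (ℤ → B)) :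
    Prop where
  injective_left : Injective f
  injective_right : Injective g
  shiftInvariant_left : ShiftInvariant X
  shiftInvariant_right : ShiftInvariant X'
  exists_right : ∀ x ∈ X, ∃ y ∈ X', ∀ i, g (y i) = ((f (x i)).2, (f (x (i + 1))).1)
  exists_left : ∀ y ∈ X', ∃ x ∈ X, ∀ i, f (x i) = ((g (y i)).2, (g (y (i + 1))).1)

theorem IsBipartite.symm (h : IsBipartite f g X X') : IsBipartite g f X' X :=
  ⟨h.injective_right, h.injective_left, h.shiftInvariant_right, h.shiftInvariant_left,
    h.exists_left, h.exists_right⟩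

/-- The image under the bipartite code of the set of sequences in `C` that begin with `d`. -/
def halfStep (f : A → D × E) (g : B → E × D) (d : D) (C : Set (ℕ → A)) : Set (ℕ → B) :=
  {s | ∃ r ∈ C, (f (r 0)).1 = d ∧ ∀ i, g (s i) = ((f (r i)).2, (f (r (i + 1))).1)}

theorem halfStep_mono {d : D} {C C' : Set (ℕ → A)} (h : C ⊆ C') :
    halfStep f g d C ⊆ halfStep f g d C' := by
  rintro s ⟨r, hr, hs⟩
  exact ⟨r, h hr, hs⟩

/-- The bipartite code is defined on all sequences in `C`. -/
def Codable (f : A → D × E) (g : B → E × D) (C : Set (ℕ → A)) : Prop :=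
  ∀ r ∈ C, ∀ i, ∃ b, g b = ((f (r i)).2, (f (r (i + 1))).1)

theorem Codable.exists_mem_halfStep {C : Set (ℕ → A)} (hC : Codable f g C) {r : ℕ → A}
    (hr : r ∈ C) : ∃ s ∈ halfStep f g (f (r 0)).1 C,
      ∀ i, g (s i) = ((f (r i)).2, (f (r (i + 1))).1) := by
  choose s hs using hC r hr
  exact ⟨s, ⟨r, hr, rfl, hs⟩, hs⟩

/-- The code reads two adjacent symbols, so one symbol of length is lost. Codability of `C'` is
needed because a member of `halfStep` is an entire coded sequence, not just a prefix. -/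
theorem IsBipartite.initialWords_halfStep_subset (h : IsBipartite f g X X') {n : ℕ} (d : D)
    {C C' : Set (ℕ → A)} (hC' : Codable f g C')
    (e : initialWords (n + 1) C ⊆ initialWords (n + 1) C') :
    initialWords n (halfStep f g d C) ⊆ initialWords n (halfStep f g d C') := by
  rw [initialWords_subset_iff] at e ⊢
  rintro s ⟨r, hr, h0, hs⟩
  obtain ⟨r', hr', e'⟩ := e r hr
  obtain ⟨s', hs', hg⟩ := hC'.exists_mem_halfStep hr'
  rw [e' 0 n.succ_pos, h0] at hs'
  refine ⟨s', hs', fun i hi => h.injective_right ?_⟩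
  rw [hg, hs, e' i (by omega), e' (i + 1) (by omega)]

theorem IsBipartite.initialWords_halfStep_congr (h : IsBipartite f g X X') {n : ℕ} (d : D)
    {C C' : Set (ℕ → A)} (hC : Codable f g C) (hC' : Codable f g C')
    (e : initialWords (n + 1) C = initialWords (n + 1) C') :
    initialWords n (halfStep f g d C) = initialWords n (halfStep f g d C') :=
  (h.initialWords_halfStep_subset d hC' e.subset).antisymm
    (h.initialWords_halfStep_subset d hC e.superset)

theorem IsBipartite.codable_followerSet (h : IsBipartite f g X X') (x : ℤ → A) :
    Codable f g (followerSet X x) := by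
  rintro r ⟨z, hz, -, hzr⟩ i
  obtain ⟨y, -, hy⟩ := h.exists_right z hz
  refine ⟨y (i + 1), ?_⟩
  rw [hy, hzr, ← hzr (i + 1)]
  push_cast
  rfl

/-- Two steps of a bipartite code make up a shift. -/
theorem IsBipartite.halfStep_halfStep (h : IsBipartite f g X X') {C : Set (ℕ → A)}
    (hC : Codable f g C) {a : A} {d : D} {e : E} (ha : f a = (d, e)) :
    halfStep g f e (halfStep f g d C) = dropSymbol a C := by
  -- With `f (r i) = (d_i, e_i)`, the symbol `s i` codes `(e_i, d_{i+1})` and `t i` codes `(d_{i+1},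
  -- e_{i+1})`, which is `f (r (i + 1))`.
  ext t
  constructor
  · rintro ⟨s, ⟨r, hr, hr0, hs⟩, hs0, ht⟩
    refine ⟨r, hr, h.injective_left (ha ▸ Prod.ext hr0 ?_), funext fun i => h.injective_left ?_⟩
    · rw [← hs0, hs]
    · rw [ht, hs, hs]
  · rintro ⟨r, hr, rfl, rfl⟩
    obtain ⟨s, hs, hg⟩ := hC.exists_mem_halfStep hr
    refine ⟨s, by simpa [ha] using hs, by rw [hg, ha], fun i => ?_⟩
    rw [hg, hg]

theorem Codable.exists_head_halfStep_iff {C : Set (ℕ → A)} (hC : Codable f g C) {d : D} {e : E} :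
    (∃ s ∈ halfStep f g d C, (g (s 0)).1 = e) ↔ ∃ a, f a = (d, e) ∧ ∃ r ∈ C, r 0 = a := by
  constructor
  · rintro ⟨s, ⟨r, hr, hr0, hs⟩, hs0⟩
    exact ⟨r 0, Prod.ext hr0 (by rw [← hs0, hs]), r, hr, rfl⟩
  · rintro ⟨_, ha, r, hr, rfl⟩
    obtain ⟨s, hs, hg⟩ := hC.exists_mem_halfStep hr
    exact ⟨s, by simpa [ha] using hs, by rw [hg, ha]⟩

/-- A first image symbol `b` forces both halves of `f (r 0)`, hence `r 0 = a`, and forces the next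
source symbol to start with `d'`. -/
theorem IsBipartite.dropSymbol_halfStep (h : IsBipartite f g X X') (C : Set (ℕ → A)) {a : A}
    {b : B} {d d' : D} {e : E} (ha : f a = (d, e)) (hb : g b = (e, d')) :
    dropSymbol b (halfStep f g d C) = halfStep f g d' (dropSymbol a C) := by
  ext t
  constructor
  · rintro ⟨s, ⟨r, hr, hr0, hs⟩, rfl, rfl⟩
    have h0 := hs 0
    rw [hb, Prod.mk.injEq] at h0
    exact ⟨_, ⟨r, hr, h.injective_left (ha ▸ Prod.ext hr0 h0.1.symm), rfl⟩, h0.2.symm,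
      fun i => hs (i + 1)⟩
  · rintro ⟨_, ⟨r, hr, rfl, rfl⟩, h1, ht⟩
    refine ⟨fun i => Nat.casesOn i b t, ⟨r, hr, by rw [ha], fun i => ?_⟩, rfl, rfl⟩
    cases i with
    | zero => exact hb.trans (by rw [ha, ← h1])
    | succ i => exact ht i

/-- Matches the domains of the two compositions in `dropSymbol_halfStep`: half step then edge, and
edge then half step. -/
theorem Codable.exists_symbol_halfStep_iff {C : Set (ℕ → A)} (hC : Codable f g C) {d d' : D} {e : E} :
    (∃ b, g b = (e, d') ∧ ∃ s ∈ halfStep f g d C, s 0 = b) ↔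
      ∃ a, f a = (d, e) ∧ ∃ t ∈ dropSymbol a C, (f (t 0)).1 = d' := by
  constructor
  · rintro ⟨_, hb, s, ⟨r, hr, hr0, hs⟩, rfl⟩
    have h0 := hs 0
    rw [hb, Prod.mk.injEq] at h0
    exact ⟨r 0, Prod.ext hr0 h0.1.symm, _, ⟨r, hr, rfl, rfl⟩, h0.2.symm⟩
  · rintro ⟨_, ha, _, ⟨r, hr, rfl, rfl⟩, h1⟩
    obtain ⟨s, hs, hg⟩ := hC.exists_mem_halfStep hr
    refine ⟨s 0, ?_, s, by simpa [ha] using hs, rfl⟩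
    rw [hg, ha, ← h1]

/-- The bipartite code maps `Γ⁺` to `Γ⁺`. -/
theorem IsBipartite.exists_halfStep_followerSet (h : IsBipartite f g X X') {x : ℤ → A}
    (hx : x ∈ X) :
    ∃ y ∈ X', halfStep f g (f (x 1)).1 (followerSet X x) = followerSet X' y := by
  obtain ⟨y, hy, hyx⟩ := h.exists_right x hx
  refine ⟨y, hy, Subset.antisymm ?_ ?_⟩
  · rintro s ⟨r, ⟨z, hz, hzx, hzr⟩, hr0, hs⟩
    obtain ⟨w, hw, hwz⟩ := h.exists_right z hz
    refine ⟨w, hw, fun i hi => h.injective_right ?_, fun i => h.injective_right ?_⟩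
    · rw [hwz, hyx, hzx i hi]
      rcases hi.lt_or_eq with hi | rfl
      · rw [hzx (i + 1) (by omega)]
      -- The symbol `y 0` depends on `x 1`, but only through the half that the restriction to `(f (x
      -- 1)).1` fixes.
      · rw [zero_add, ← hr0, ← hzr 0]
        simp
    · rw [hwz, hs, hzr, ← hzr (i + 1)]
      push_cast
      rfl
  · rintro s ⟨w, hw, hwy, hws⟩
    obtain ⟨z, hz, hzw⟩ := h.exists_left w hw
    -- The code from `X'` back to `X` also looks ahead, so the two codes compose to the shift; the
    -- point with past `x⁻` is `z` moved back by one place.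
    have key (i : ℤ) : f (z (i + -1)) = ((g (w (i - 1))).2, (g (w i)).1) := by
      rw [hzw]
      simp [sub_eq_add_neg]
    refine ⟨fun i => z i, ⟨_, h.shiftInvariant_left (-1) z hz, fun i hi => h.injective_left ?_,
      fun i => by simp⟩, ?_, fun i => ?_⟩
    · rw [key, hwy _ (by omega), hwy i hi, hyx, hyx]
      simp
    · have := key 1
      simp only [add_neg_cancel, sub_self] at this
      simp only [Nat.cast_zero, this, hwy 0 le_rfl, hyx, zero_add]
    · rw [hzw, hzw]
      push_cast
      rw [hws]

variable [TopologicalSpace A] [DiscreteTopology A]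

/-- A source sequence is determined by `d` and its image: this is `F` below. Sources of
approximations to `s` therefore stabilize coordinatewise, and their diagonal is a source of `s`. -/
theorem IsBipartite.isClosed_halfStep [TopologicalSpace B] [DiscreteTopology B]
    (h : IsBipartite f g X X') (d : D) {C : Set (ℕ → A)} (hC : IsClosed C) :
    IsClosed (halfStep f g d C) := by
  refine isClosed_of_forall_prefix fun s hs => ?_
  choose t ht hts using hs
  choose r hr hr0 hrt using ht
  let F : ℕ → D × E := fun i =>
    Nat.casesOn i (d, (g (s 0)).1) fun i => ((g (s i)).2, (g (s (i + 1))).1)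
  have hF (n i : ℕ) (hi : i < n) : f (r n i) = F i := by
    cases i with
    | zero =>
      change _ = (d, (g (s 0)).1)
      exact Prod.ext (hr0 n) (by rw [← hts n 0 hi, hrt])
    | succ i =>
      change _ = ((g (s i)).2, (g (s (i + 1))).1)
      rw [← hts n i (by omega), ← hts n (i + 1) hi, hrt, hrt]
  refine ⟨fun i => r (i + 1) i, mem_of_isClosed_of_forall_prefix hC fun n => ⟨r n, hr n,
    fun i hi => h.injective_left ?_⟩, hr0 1, fun i => ?_⟩
  · rw [hF n i hi, hF (i + 1) i i.lt_succ_self]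
  · rw [hF (i + 1) i i.lt_succ_self, hF (i + 2) (i + 1) (by omega)]
    refine Prod.ext ?_ rfl
    cases i <;> rfl

variable [Finite A]

/-- Codability at `i` concerns a prefix of length `i + 2` only, and that prefix occurs in a follower
set. -/
theorem IsBipartite.codable_of_mem_shannonVertices (h : IsBipartite f g X X')
    {C : Set (ℕ → A)} (hC : C ∈ shannonVertices X) : Codable f g C := by
  intro r hr i
  obtain ⟨x, -, e⟩ := (mem_shannonVertices_iff.1 hC).2 (i + 2)
  obtain ⟨r', hr', e'⟩ := exists_of_initialWords_eq e hr
  rw [← e' i (by omega), ← e' (i + 1) (by omega)]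
  exact h.codable_followerSet x r' hr' i

theorem IsBipartite.halfStep_mem_shannonVertices [TopologicalSpace B] [DiscreteTopology B]
    [Finite B] (h : IsBipartite f g X X') {C : Set (ℕ → A)} (hC : C ∈ shannonVertices X) {d : D}
    (hd : ∃ r ∈ C, (f (r 0)).1 = d) : halfStep f g d C ∈ shannonVertices X' := by
  refine mem_shannonVertices_iff.2 ⟨h.isClosed_halfStep d hC.1, fun n => ?_⟩
  obtain ⟨x, hx, rfl, e⟩ :=
    exists_followerSet_of_mem_shannonVertices hC (P := fun a => (f a).1 = d) hd n
  obtain ⟨y, hy, e'⟩ := h.exists_halfStep_followerSet hx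
  refine ⟨y, hy, ?_⟩
  rw [← e', h.initialWords_halfStep_congr _ (h.codable_of_mem_shannonVertices hC)
    (h.codable_followerSet x) e]

end Bipartite

/-! ### Symbolic matrices with entries `0` and `1` -/

namespace SymbolicMatrix

variable {I J K A B : Type u}

open Classical in
/-- The symbolic matrix whose multiplicities are given by a relation. -/
noncomputable def indicator (P : I → J → A → Prop) : SymbolicMatrix I J A :=
  fun i j a => if P i j a then 1 else 0

open Classical in
/-- The `0`-`1` matrix of a relation. -/
noncomputable def natIndicator (N : I → J → Prop) : I → J → ℕ := fun i j => if N i j then 1 else 0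

theorem indicator_congr {P Q : I → J → A → Prop} (h : ∀ i j a, P i j a ↔ Q i j a) :
    indicator P = indicator Q := by
  rw [show P = Q from funext₃ fun i j a => propext (h i j a)]

/-- Uniqueness leaves at most one nonzero summand, so products of 0-1 matrices become compositions
of relations, without multiplicities. -/
theorem sum_ite_mul_ite [Fintype J] (P Q : J → Prop) {_ : DecidablePred P} {_ : DecidablePred Q}
    {_ : Decidable (∃ j, P j ∧ Q j)} (hP : ∀ j j', P j → P j' → j = j') :
    ∑ j, (if P j then 1 else 0) * (if Q j then 1 else 0) = if ∃ j, P j ∧ Q j then 1 else 0 := by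
  by_cases h : ∃ j, P j ∧ Q j
  · obtain ⟨j, hj, hQ⟩ := h
    rw [if_pos ⟨j, hj, hQ⟩, Finset.sum_eq_single j]
    · simp [hj, hQ]
    · intro k _ hk
      rw [if_neg fun hPk => hk (hP k j hPk hj), zero_mul]
    · simp
  · rw [if_neg h]
    refine Finset.sum_eq_zero fun j _ => ?_
    by_cases hj : P j
    · rw [if_neg fun hQ => h ⟨j, hj, hQ⟩, mul_zero]
    · rw [if_neg hj, zero_mul]

theorem mul_indicator [Fintype J] {P : I → J → A → Prop} {Q : J → K → B → Prop}
    (hP : ∀ i a j j', P i j a → P i j' a → j = j') :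
    (indicator P).mul (indicator Q) = indicator fun i k w => ∃ j, P i j w.1 ∧ Q j k w.2 :=
  funext₃ fun i k w => sum_ite_mul_ite (P i · w.1) (Q · k w.2) (hP i w.1)

theorem mulNat_indicator [Fintype J] {P : I → J → A → Prop} {N : J → K → Prop}
    (hP : ∀ i a j j', P i j a → P i j' a → j = j') :
    (indicator P).mulNat (natIndicator N) = indicator fun i k a => ∃ j, P i j a ∧ N j k :=
  funext₃ fun i k a => sum_ite_mul_ite (P i · a) (N · k) (hP i a)

theorem natMul_indicator [Fintype J] {N : I → J → Prop} {P : J → K → A → Prop}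
    (hN : ∀ i j j', N i j → N i j' → j = j') :
    natMul (natIndicator N) (indicator P) = indicator fun i k a => ∃ j, N i j ∧ P j k a :=
  funext₃ fun i k a => sum_ite_mul_ite (N i) (P · k a) (hN i)

theorem map_indicator [Fintype A] {f : A → B} (hf : Injective f) {P : I → J → A → Prop} :
    (indicator P).map f = indicator fun i j b => ∃ a, f a = b ∧ P i j a := by
  classical
  funext i j b
  refine Eq.trans ?_ (@sum_ite_mul_ite _ _ (fun a => f a = b) (P i j) (Classical.decPred _)
    (Classical.decPred _) _ fun a a' h h' => hf (h.trans h'.symm))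
  exact Finset.sum_congr rfl fun a _ => by by_cases h : f a = b <;> simp [h, indicator]

end SymbolicMatrix

section HalfEdges

variable {A B D E : Type u} {f : A → D × E} {g : B → E × D}

/-! ### Half steps in the core -/

/-- The half step `halfStep`, applied to both components of a pair. -/
def halfPair (f : A → D × E) (g : B → E × D) (d : D) (p : Set (ℕ → A) × Set (ℕ → A)) :
    Set (ℕ → B) × Set (ℕ → B) :=
  (halfStep f g d p.1, halfStep f g d p.2)

/-- There is an edge labeled `d` from `c` to `c'`, where `c'` is the image of `c` under the bipartite
code, restricted to sequences that begin with `d`. -/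
def HalfEdge [TopologicalSpace A] [TopologicalSpace B] (f : A → D × E) (g : B → E × D) {Y X : Set (ℤ → A)}
    {Y' X' : Set (ℤ → B)} {n : ℕ} (c : levelVertices Y X (n + 1)) (d : D) (c' : levelVertices Y' X' n) : Prop :=
  ∃ p ∈ coreVertices Y X, c.1 = pairWords (n + 1) p ∧ (∃ r ∈ p.1, (f (r 0)).1 = d) ∧
    c'.1 = pairWords n (halfPair f g d p)

variable {Y X : Set (ℤ → A)} {Y' X' : Set (ℤ → B)}
  (hY : IsBipartite f g Y Y') (hX : IsBipartite f g X X')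

include hY hX

theorem dropPair_halfPair (p : Set (ℕ → A) × Set (ℕ → A)) {a : A} {b : B} {d d' : D} {e : E}
    (ha : f a = (d, e)) (hb : g b = (e, d')) :
    dropPair b (halfPair f g d p) = halfPair f g d' (dropPair a p) :=
  Prod.ext (hY.dropSymbol_halfStep p.1 ha hb) (hX.dropSymbol_halfStep p.2 ha hb)

variable [TopologicalSpace A] [Fintype A] [DiscreteTopology A]

theorem halfPair_halfPair {p : Set (ℕ → A) × Set (ℕ → A)} (hp : p ∈ pairVertices Y X) {a : A}
    {d : D} {e : E} (ha : f a = (d, e)) :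
    halfPair g f e (halfPair f g d p) = dropPair a p :=
  Prod.ext (hY.halfStep_halfStep (hY.codable_of_mem_shannonVertices hp.1) ha)
    (hX.halfStep_halfStep (hX.codable_of_mem_shannonVertices hp.2.1) ha)

variable [TopologicalSpace B]

/-- Half edges do not depend on the representative in the core, as `n + 1` symbols of the source
determine `n` symbols of the image. -/
theorem halfEdge_iff {n : ℕ} {p : Set (ℕ → A) × Set (ℕ → A)} (hp : p ∈ coreVertices Y X) {d : D}
    {c : levelVertices Y' X' n} :
    HalfEdge f g (levelVertex (n + 1) p hp) d c ↔
      (∃ r ∈ p.1, (f (r 0)).1 = d) ∧ c.1 = pairWords n (halfPair f g d p) := by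
  refine ⟨?_, fun h => ⟨p, hp, rfl, h⟩⟩
  rintro ⟨q, hq, e, hd, hc⟩
  have e1 : initialWords (n + 1) p.1 = initialWords (n + 1) q.1 := congrArg Prod.fst e
  have e2 : initialWords (n + 1) p.2 = initialWords (n + 1) q.2 := congrArg Prod.snd e
  have hpP := coreVertices_subset hY.shiftInvariant_left hX.shiftInvariant_left hp
  have hqP := coreVertices_subset hY.shiftInvariant_left hX.shiftInvariant_left hq
  refine ⟨(exists_head_iff_of_initialWords_eq (fun a => (f a).1 = d) e1).2 hd, hc.trans ?_⟩
  exact Prod.ext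
    (hY.initialWords_halfStep_congr d (hY.codable_of_mem_shannonVertices hqP.1)
      (hY.codable_of_mem_shannonVertices hpP.1) e1.symm)
    (hX.initialWords_halfStep_congr d (hX.codable_of_mem_shannonVertices hqP.2.1)
      (hX.codable_of_mem_shannonVertices hpP.2.1) e2.symm)

theorem halfEdge_unique {n : ℕ} (c : levelVertices Y X (n + 1)) (d : D)
    (c' c'' : levelVertices Y' X' n) (h : HalfEdge f g c d c') (h' : HalfEdge f g c d c'') :
    c' = c'' := by
  obtain ⟨p, hp, rfl⟩ := exists_eq_levelVertex c
  rw [halfEdge_iff hY hX] at h h'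
  exact Subtype.ext (h.2.trans h'.2.symm)

variable [Fintype B] [DiscreteTopology B]

theorem halfPair_mem_pairVertices {p : Set (ℕ → A) × Set (ℕ → A)} (hp : p ∈ pairVertices Y X)
    {d : D} (hd : ∃ r ∈ p.1, (f (r 0)).1 = d) : halfPair f g d p ∈ pairVertices Y' X' := by
  obtain ⟨h1, h2, h3⟩ := hp
  obtain ⟨r, hr, h0⟩ := hd
  exact ⟨hY.halfStep_mem_shannonVertices h1 ⟨r, hr, h0⟩,
    hX.halfStep_mem_shannonVertices h2 ⟨r, h3 hr, h0⟩, halfStep_mono h3⟩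

/-- Half steps commute with edges, so a path of length `n` ending at `p` is carried to one ending at
`halfPair f g d p`. -/
theorem halfPair_mem_pairSuccessors_iterate (n : ℕ) :
    ∀ p ∈ pairSuccessors^[n] (pairVertices Y X), ∀ d, (∃ r ∈ p.1, (f (r 0)).1 = d) →
      halfPair f g d p ∈ pairSuccessors^[n] (pairVertices Y' X') := by
  induction n with
  | zero => exact fun p hp d hd => halfPair_mem_pairVertices hY hX hp hd
  | succ n ih =>
    intro p hp d hd
    have hsub := pairSuccessors_iterate_subset hY.shiftInvariant_left hX.shiftInvariant_left n
    rw [iterate_succ_apply', mem_pairSuccessors_iff hsub] at hp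
    obtain ⟨q, hq, a, ha, rfl⟩ := hp
    obtain ⟨b, hb, s, hs, hs0⟩ := (hY.codable_of_mem_shannonVertices
      (hsub hq).1).exists_symbol_halfStep_iff.2 ⟨a, rfl, hd⟩
    rw [iterate_succ_apply', mem_pairSuccessors_iff (pairSuccessors_iterate_subset
      hY.shiftInvariant_right hX.shiftInvariant_right n)]
    refine ⟨_, ih q hq (f a).1 ?_, b, ⟨s, hs, hs0⟩, (dropPair_halfPair hY hX q rfl hb).symm⟩
    obtain ⟨r, hr, rfl⟩ := ha
    exact ⟨r, hr, rfl⟩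

theorem halfPair_mem_coreVertices {p : Set (ℕ → A) × Set (ℕ → A)} (hp : p ∈ coreVertices Y X)
    {d : D} (hd : ∃ r ∈ p.1, (f (r 0)).1 = d) : halfPair f g d p ∈ coreVertices Y' X' := by
  rw [mem_coreVertices_iff hY.shiftInvariant_left hX.shiftInvariant_left] at hp
  rw [mem_coreVertices_iff hY.shiftInvariant_right hX.shiftInvariant_right]
  exact fun n => halfPair_mem_pairSuccessors_iterate hY hX n p (hp n) d hd

/-- Every vertex of the core is the final vertex of a half step from the other core. -/
theorem exists_halfPair_eq {q : Set (ℕ → B) × Set (ℕ → B)} (hq : q ∈ coreVertices Y' X') :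
    ∃ p ∈ coreVertices Y X, ∃ d, (∃ r ∈ p.1, (f (r 0)).1 = d) ∧ q = halfPair f g d p := by
  obtain ⟨q₀, hq₀, b, hb, rfl⟩ := exists_predecessor_mem_coreVertices hY.shiftInvariant_right
    hX.shiftInvariant_right hq
  have hq₀P := coreVertices_subset hY.shiftInvariant_right hX.shiftInvariant_right hq₀
  -- The edge labeled `b` from `q₀` splits into two half steps; the vertex between them lies in the
  -- other core.
  refine ⟨_, halfPair_mem_coreVertices hY.symm hX.symm hq₀ (d := (g b).1) ?_, (g b).2, ?_,
    (halfPair_halfPair hY.symm hX.symm hq₀P rfl).symm⟩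
  · obtain ⟨r, hr, rfl⟩ := hb
    exact ⟨r, hr, rfl⟩
  · exact (hY.symm.codable_of_mem_shannonVertices hq₀P.1).exists_head_halfStep_iff.2 ⟨b, rfl, hb⟩

theorem exists_halfEdge_iff {n : ℕ} {p : Set (ℕ → A) × Set (ℕ → A)} (hp : p ∈ coreVertices Y X)
    {d : D} {P : levelVertices Y' X' n → Prop} :
    (∃ c, HalfEdge f g (levelVertex (n + 1) p hp) d c ∧ P c) ↔
      ∃ hd : ∃ r ∈ p.1, (f (r 0)).1 = d,
        P (levelVertex n (halfPair f g d p) (halfPair_mem_coreVertices hY hX hp hd)) := by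
  constructor
  · rintro ⟨c, hc, hP⟩
    obtain ⟨hd, e⟩ := (halfEdge_iff hY hX hp).1 hc
    refine ⟨hd, ?_⟩
    rwa [← (eq_levelVertex_iff (c := c)).2 e]
  · rintro ⟨hd, hP⟩
    exact ⟨_, (halfEdge_iff hY hX hp).2 ⟨hd, rfl⟩, hP⟩

/-- Two half steps lose two levels but amount to a single `τ_a`; `ι` accounts for the other level.
-/
theorem halfEdge_comp_halfEdge_iff {n : ℕ} (c : levelVertices Y X (n + 2))
    (c' : levelVertices Y X n) (d : D) (e : E) :
    (∃ c'' : levelVertices Y' X' (n + 1), HalfEdge f g c d c'' ∧ HalfEdge g f c'' e c') ↔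
      ∃ a, f a = (d, e) ∧ ∃ c'', (pairSystem Y X).edge (n + 1) c a c'' ∧
        (pairSystem Y X).ι n c'' = c' := by
  obtain ⟨p, hp, rfl⟩ := exists_eq_levelVertex c
  have hpP := coreVertices_subset hY.shiftInvariant_left hX.shiftInvariant_left hp
  rw [exists_halfEdge_iff hY hX hp]
  constructor
  · rintro ⟨hd, h⟩
    obtain ⟨he, e'⟩ := (halfEdge_iff hY.symm hX.symm _).1 h
    obtain ⟨a, ha, hr⟩ :=
      (hY.codable_of_mem_shannonVertices hpP.1).exists_head_halfStep_iff.1 he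
    refine ⟨a, ha, (pairSystem_exists_edge_iff hY.shiftInvariant_left hX.shiftInvariant_left
      hp (P := fun x => (pairSystem Y X).ι n x = c')).2 ⟨hr, ?_⟩⟩
    refine (pairSystem_ι_levelVertex n _).trans (Subtype.ext ?_)
    rw [e', halfPair_halfPair hY hX hpP ha]
    rfl
  · rintro ⟨a, ha, h⟩
    obtain ⟨hr, h⟩ := (pairSystem_exists_edge_iff hY.shiftInvariant_left hX.shiftInvariant_left
      hp (P := fun x => (pairSystem Y X).ι n x = c')).1 h
    have hd : ∃ r ∈ p.1, (f (r 0)).1 = d := by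
      obtain ⟨r, hr, rfl⟩ := hr
      exact ⟨r, hr, by rw [ha]⟩
    refine ⟨hd, (halfEdge_iff hY.symm hX.symm _).2
      ⟨(hY.codable_of_mem_shannonVertices hpP.1).exists_head_halfStep_iff.2 ⟨a, ha, hr⟩, ?_⟩⟩
    rw [← h, halfPair_halfPair hY hX hpP ha]
    exact congrArg Subtype.val (pairSystem_ι_levelVertex n _)

theorem halfEdge_comp_edge_iff {n : ℕ} (c : levelVertices Y X (n + 2))
    (c' : levelVertices Y' X' n) (d d' : D) (e : E) :
    (∃ c'' : levelVertices Y' X' (n + 1), HalfEdge f g c d c'' ∧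
        ∃ b, g b = (e, d') ∧ (pairSystem Y' X').edge n c'' b c') ↔
      ∃ c'' : levelVertices Y X (n + 1),
        (∃ a, f a = (d, e) ∧ (pairSystem Y X).edge (n + 1) c a c'') ∧ HalfEdge f g c'' d' c' := by
  obtain ⟨p, hp, rfl⟩ := exists_eq_levelVertex c
  have hpP := coreVertices_subset hY.shiftInvariant_left hX.shiftInvariant_left hp
  have hcod := hY.codable_of_mem_shannonVertices hpP.1
  rw [exists_halfEdge_iff hY hX hp]
  constructor
  · rintro ⟨hd, b, hb, h⟩
    obtain ⟨hs, e'⟩ := (pairSystem_edge_iff hY.shiftInvariant_right hX.shiftInvariant_right _).1 h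
    obtain ⟨a, ha, t, ht, ht'⟩ := hcod.exists_symbol_halfStep_iff.1 ⟨b, hb, hs⟩
    have hr : ∃ r ∈ p.1, r 0 = a := by
      obtain ⟨r, hr, h0, -⟩ := ht
      exact ⟨r, hr, h0⟩
    refine ⟨_, ⟨a, ha, (pairSystem_edge_iff hY.shiftInvariant_left hX.shiftInvariant_left hp
      (c := levelVertex _ _ (dropPair_mem_coreVertices hY.shiftInvariant_left
        hX.shiftInvariant_left hp hr))).2 ⟨hr, rfl⟩⟩,
      (halfEdge_iff hY hX _).2 ⟨⟨t, ht, ht'⟩, ?_⟩⟩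
    rw [e', dropPair_halfPair hY hX p ha hb]
  · rintro ⟨c'', ⟨a, ha, h⟩, h'⟩
    obtain ⟨hr, e'⟩ := (pairSystem_edge_iff hY.shiftInvariant_left hX.shiftInvariant_left hp).1 h
    obtain rfl := (eq_levelVertex_iff (hp := dropPair_mem_coreVertices hY.shiftInvariant_left
      hX.shiftInvariant_left hp hr)).2 e'
    obtain ⟨ht, e''⟩ := (halfEdge_iff hY hX _).1 h'
    obtain ⟨b, hb, hs⟩ := hcod.exists_symbol_halfStep_iff.2 ⟨a, ha, ht⟩
    have hd : ∃ r ∈ p.1, (f (r 0)).1 = d := by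
      obtain ⟨r, hr, rfl⟩ := hr
      exact ⟨r, hr, by rw [ha]⟩
    refine ⟨hd, b, hb,
      (pairSystem_edge_iff hY.shiftInvariant_right hX.shiftInvariant_right _).2 ⟨hs, ?_⟩⟩
    rw [e'', dropPair_halfPair hY hX p ha hb]

theorem halfEdge_comp_ι_iff {n : ℕ} (c : levelVertices Y X (n + 2))
    (c' : levelVertices Y' X' n) (d : D) :
    (∃ c'' : levelVertices Y' X' (n + 1), HalfEdge f g c d c'' ∧
        (pairSystem Y' X').ι n c'' = c') ↔
      ∃ c'' : levelVertices Y X (n + 1),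
        (pairSystem Y X).ι (n + 1) c = c'' ∧ HalfEdge f g c'' d c' := by
  obtain ⟨p, hp, rfl⟩ := exists_eq_levelVertex c
  rw [exists_halfEdge_iff hY hX hp]
  refine Iff.trans ?_ exists_eq_left'.symm
  refine Iff.trans (Iff.trans ?_ (halfEdge_iff hY hX hp).symm)
    (iff_of_eq (congrArg (fun x => HalfEdge f g x d c')
      (pairSystem_ι_levelVertex (n + 1) hp))).symm
  rw [← exists_prop]
  refine exists_congr fun hd => ?_
  rw [pairSystem_ι_levelVertex]
  exact eq_comm.trans eq_levelVertex_iff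

/-- Labels do not depend on the level, so the witnessing paths are built at the lowest levels. -/
theorem exists_isLabelWord_iff (w : E × D) :
    (∃ a b, (pairSystem Y X).IsLabelWord a b ∧ ((f a).2, (f b).1) = w) ↔
      ∃ c, (pairSystem Y' X').IsLabel c ∧ g c = w := by
  constructor
  · rintro ⟨a, b, ⟨n, c, c', c'', hab, hbc⟩, rfl⟩
    obtain ⟨p, hp, rfl⟩ := exists_eq_levelVertex c
    have hpP := coreVertices_subset hY.shiftInvariant_left hX.shiftInvariant_left hp
    obtain ⟨hr, e'⟩ :=
      (pairSystem_edge_iff hY.shiftInvariant_left hX.shiftInvariant_left hp).1 hab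
    obtain rfl := (eq_levelVertex_iff (hp := dropPair_mem_coreVertices hY.shiftInvariant_left
      hX.shiftInvariant_left hp hr)).2 e'
    obtain ⟨⟨t, ht, rfl⟩, -⟩ :=
      (pairSystem_edge_iff hY.shiftInvariant_left hX.shiftInvariant_left _).1 hbc
    obtain ⟨y, hy, hs⟩ := (hY.codable_of_mem_shannonVertices
      hpP.1).exists_symbol_halfStep_iff.2 ⟨a, rfl, t, ht, rfl⟩
    have hd : ∃ r ∈ p.1, (f (r 0)).1 = (f a).1 := by
      obtain ⟨r, hr, rfl⟩ := hr
      exact ⟨r, hr, rfl⟩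
    have hq := halfPair_mem_coreVertices hY hX hp hd
    exact ⟨y, ⟨0, levelVertex 1 _ hq, levelVertex 0 _ (dropPair_mem_coreVertices
      hY.shiftInvariant_right hX.shiftInvariant_right hq hs), (pairSystem_edge_iff
      hY.shiftInvariant_right hX.shiftInvariant_right hq).2 ⟨hs, rfl⟩⟩, hy⟩
  · rintro ⟨y, ⟨n, c, c', h⟩, rfl⟩
    obtain ⟨q, hq, rfl⟩ := exists_eq_levelVertex c
    obtain ⟨hs, -⟩ :=
      (pairSystem_edge_iff hY.shiftInvariant_right hX.shiftInvariant_right hq).1 h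
    obtain ⟨p, hp, d, hd, rfl⟩ := exists_halfPair_eq hY hX hq
    have hpP := coreVertices_subset hY.shiftInvariant_left hX.shiftInvariant_left hp
    obtain ⟨s, ⟨r, hr, -, hrs⟩, rfl⟩ := hs
    have ha : ∃ t ∈ p.1, t 0 = r 0 := ⟨r, hr, rfl⟩
    have hp' := dropPair_mem_coreVertices hY.shiftInvariant_left hX.shiftInvariant_left hp ha
    have hb : ∃ t ∈ (dropPair (r 0) p).1, t 0 = r 1 := ⟨_, ⟨r, hr, rfl, rfl⟩, rfl⟩
    exact ⟨r 0, r 1, ⟨0, levelVertex 2 p hp, levelVertex 1 _ hp', levelVertex 0 _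
      (dropPair_mem_coreVertices hY.shiftInvariant_left hX.shiftInvariant_left hp' hb),
      (pairSystem_edge_iff hY.shiftInvariant_left hX.shiftInvariant_left hp).2 ⟨ha, rfl⟩,
      (pairSystem_edge_iff hY.shiftInvariant_left hX.shiftInvariant_left hp').2 ⟨hb, rfl⟩⟩,
      (hrs 0).symm⟩

end HalfEdges

namespace LabeledBratteli

/-! ### Relations in place of symbolic matrices -/

theorem M_eq_indicator (L : LabeledBratteli.{u}) (n : ℕ) :
    L.M n = SymbolicMatrix.indicator fun c c' a => L.edge n c a c' := rfl

theorem I_eq_natIndicator (L : LabeledBratteli.{u}) (n : ℕ) :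
    L.I n = SymbolicMatrix.natIndicator fun c c' => L.ι n c = c' := rfl

variable {L L' : LabeledBratteli.{u}} {D E : Type u} {φ : L.Alphabet → D × E}
  {ψ : L'.Alphabet → E × D} {n : ℕ}

open SymbolicMatrix

theorem indicator_mul_indicator (hL : L.IsLambdaGraphSystem) (hφ : Injective φ)
    {H : L.V (n + 2) → D → L'.V (n + 1) → Prop} {H' : L'.V (n + 1) → E → L.V n → Prop}
    (hH : ∀ c d c' c'', H c d c' → H c d c'' → c' = c'')
    (h : ∀ c c' d e, (∃ c'', H c d c'' ∧ H' c'' e c') ↔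
      ∃ a, φ a = (d, e) ∧ ∃ c'', L.edge (n + 1) c a c'' ∧ L.ι n c'' = c') :
    (indicator fun c c' d => H c d c').mul (indicator fun c c' e => H' c e c') =
      ((L.M (n + 1)).mulNat (L.I n)).map φ := by
  rw [M_eq_indicator, I_eq_natIndicator, mulNat_indicator (hL.right_resolving (n + 1)),
    map_indicator hφ, mul_indicator hH]
  exact indicator_congr fun c c' w => h c c' w.1 w.2

theorem indicator_mul_map (hL : L.IsLambdaGraphSystem) (hφ : Injective φ) (hψ : Injective ψ)
    {H : L.V (n + 2) → D → L'.V (n + 1) → Prop} {H' : L.V (n + 1) → D → L'.V n → Prop}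
    (hH : ∀ c d c' c'', H c d c' → H c d c'' → c' = c'')
    (h : ∀ c c' d d' e, (∃ c'', H c d c'' ∧ ∃ b, ψ b = (e, d') ∧ L'.edge n c'' b c') ↔
      ∃ c'', (∃ a, φ a = (d, e) ∧ L.edge (n + 1) c a c'') ∧ H' c'' d' c') (i j d e d') :
    (indicator fun c c' d => H c d c').mul ((L'.M n).map ψ) i j (d, (e, d')) =
      ((L.M (n + 1)).map φ).mul (indicator fun c c' d => H' c d c') i j ((d, e), d') := by
  rw [M_eq_indicator, M_eq_indicator, map_indicator hφ, map_indicator hψ, mul_indicator hH,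
    mul_indicator]
  · exact congrArg (fun p => @ite ℕ p (Classical.propDecidable p) 1 0) (propext (h i j d d' e))
  · rintro i _ j j' ⟨a, rfl, ha⟩ ⟨a', h', ha'⟩
    obtain rfl := hφ h'
    exact hL.right_resolving _ i _ j j' ha ha'

theorem indicator_mulNat_I {H : L.V (n + 2) → D → L'.V (n + 1) → Prop}
    {H' : L.V (n + 1) → D → L'.V n → Prop}
    (hH : ∀ c d c' c'', H c d c' → H c d c'' → c' = c'')
    (h : ∀ c c' d, (∃ c'', H c d c'' ∧ L'.ι n c'' = c') ↔
      ∃ c'', L.ι (n + 1) c = c'' ∧ H' c'' d c') :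
    (indicator fun c c' d => H c d c').mulNat (L'.I n) =
      natMul (L.I (n + 1)) (indicator fun c c' d => H' c d c') := by
  rw [I_eq_natIndicator, I_eq_natIndicator, mulNat_indicator hH,
    natMul_indicator fun i j j' h h' => h.symm.trans h']
  exact indicator_congr fun c c' d => h c c' d

end LabeledBratteli

section OneStep

variable {A B D E : Type u} {f : A → D × E} {g : B → E × D}
  [TopologicalSpace A] [Fintype A] [DiscreteTopology A]
  [TopologicalSpace B] [Fintype B] [DiscreteTopology B]

/-! ### Bipartite codes induce strong shift equivalences in one step -/

open LabeledBratteli in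
theorem oneStepStrongShiftEquivalent_pairSystem [Finite D] [Finite E] {Y X : Set (ℤ → A)}
    {Y' X' : Set (ℤ → B)} (hY : IsBipartite f g Y Y') (hX : IsBipartite f g X X') :
    OneStepStrongShiftEquivalent (pairSystem Y X) (pairSystem Y' X') := by
  have hL := isLambdaGraphSystem_pairSystem hY.shiftInvariant_left hX.shiftInvariant_left
  have hL' := isLambdaGraphSystem_pairSystem hY.shiftInvariant_right hX.shiftInvariant_right
  have hu (n : ℕ) := halfEdge_unique (n := n) hY hX
  have hu' (n : ℕ) := halfEdge_unique (n := n) hY.symm hX.symm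
  refine ⟨hL, hL', D, E, inferInstance, inferInstance, f, g,
    fun n => SymbolicMatrix.indicator fun c c' d =>
      HalfEdge (Y := Y) (X := X) (Y' := Y') (X' := X') f g c d c',
    fun n => SymbolicMatrix.indicator fun c c' e =>
      HalfEdge (Y := Y') (X := X') (Y' := Y) (X' := X) g f c e c',
    ⟨hY.injective_left, hY.injective_right, exists_isLabelWord_iff hY hX,
      exists_isLabelWord_iff hY.symm hX.symm⟩, ?_, ?_, ?_, ?_, ?_, ?_⟩
  · exact fun n => indicator_mul_indicator hL hY.injective_left (hu (n + 1))
      (halfEdge_comp_halfEdge_iff hY hX)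
  · exact fun n => indicator_mul_indicator hL' hY.injective_right (hu' (n + 1))
      (halfEdge_comp_halfEdge_iff hY.symm hX.symm)
  · exact fun n => indicator_mul_map hL hY.injective_left hY.injective_right (hu (n + 1))
      (halfEdge_comp_edge_iff hY hX)
  · exact fun n => indicator_mul_map hL' hY.injective_right hY.injective_left (hu' (n + 1))
      (halfEdge_comp_edge_iff hY.symm hX.symm)
  · exact fun n => indicator_mulNat_I (hu (n + 1)) (halfEdge_comp_ι_iff hY hX)
  · exact fun n => indicator_mulNat_I (hu' (n + 1)) (halfEdge_comp_ι_iff hY.symm hX.symm)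

end OneStep

namespace LabeledBratteli

/-! ### Symmetry of strong shift equivalence and invariance of the λ-entropy -/

theorem OneStepStrongShiftEquivalent.symm {L L' : LabeledBratteli.{u}}
    (h : L.OneStepStrongShiftEquivalent L') : L'.OneStepStrongShiftEquivalent L := by
  obtain ⟨hL, hL', D, E, hD, hE, φ, ψ, K, K', hs, hr⟩ := h
  exact ⟨hL', hL, E, D, hE, hD, ψ, φ, K', K,
    ⟨hs.injective_right, hs.injective_left, hs.middle_right, hs.middle_left⟩,
    ⟨hr.mul_right, hr.mul_left, hr.comm_right, hr.comm_left, hr.comm_ι_right, hr.comm_ι_left⟩⟩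

theorem StrongShiftEquivalent.symm {L L' : LabeledBratteli.{u}}
    (h : L.StrongShiftEquivalent L') : L'.StrongShiftEquivalent L := by
  induction h with
  | single h => exact .single h.symm
  | tail _ h ih => exact .head h.symm ih

theorem StrongShiftEquivalent.trans {L L' L'' : LabeledBratteli.{u}}
    (h : L.StrongShiftEquivalent L') (h' : L'.StrongShiftEquivalent L'') :
    L.StrongShiftEquivalent L'' := Relation.TransGen.trans h h'

/-! ### Comparison of vertex numbers and growth rates -/

/-- If `P Q = φ(M I)`, then every column of `Q` is nonzero. -/
theorem exists_ne_zero_of_mul_eq {L : LabeledBratteli.{u}} (hL : L.IsLambdaGraphSystem)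
    {J D E : Type u} [Fintype J] {φ : L.Alphabet → D × E} {n : ℕ}
    {P : SymbolicMatrix (L.V (n + 2)) J D} {Q : SymbolicMatrix J (L.V n) E}
    (h : P.mul Q = ((L.M (n + 1)).mulNat (L.I n)).map φ) (v : L.V n) :
    ∃ j e, Q j v e ≠ 0 := by
  obtain ⟨c, rfl⟩ := hL.ι_surjective n v
  obtain ⟨i, a, hi⟩ := hL.exists_incoming (n + 1) c
  have hM : ((L.M (n + 1)).mulNat (L.I n)).map φ i (L.ι n c) (φ a) ≠ 0 := by
    refine (Finset.sum_pos' (fun _ _ => Nat.zero_le _) ⟨a, Finset.mem_univ a, ?_⟩).ne'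
    rw [if_pos rfl]
    refine Finset.sum_pos' (fun _ _ => Nat.zero_le _) ⟨c, Finset.mem_univ c, ?_⟩
    simp [M, I, hi]
  rw [← h] at hM
  obtain ⟨j, -, hj⟩ := Finset.exists_ne_zero_of_sum_ne_zero hM
  exact ⟨j, _, right_ne_zero_of_mul hj⟩

/-- If `P Q = φ(M I)`, then a nonzero row of `Q` to a given symbol determines the column. -/
theorem eq_of_mul_eq {L : LabeledBratteli.{u}} (hL : L.IsLambdaGraphSystem)
    {J D E : Type u} [Fintype J] {φ : L.Alphabet → D × E} (hφ : Injective φ) {n : ℕ}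
    {P : SymbolicMatrix (L.V (n + 2)) J D} {Q : SymbolicMatrix J (L.V n) E}
    (h : P.mul Q = ((L.M (n + 1)).mulNat (L.I n)).map φ) {i : L.V (n + 2)} {d : D} {j : J}
    (hP : P i j d ≠ 0) {e : E} {v w : L.V n} (hv : Q j v e ≠ 0) (hw : Q j w e ≠ 0) : v = w := by
  have key (x : L.V n) (hx : Q j x e ≠ 0) :
      ∃ a, φ a = (d, e) ∧ ∃ c, L.edge (n + 1) i a c ∧ L.ι n c = x := by
    have hne : P.mul Q i x (d, e) ≠ 0 :=
      (Finset.sum_pos' (fun _ _ => Nat.zero_le _)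
        ⟨j, Finset.mem_univ j, Nat.pos_of_ne_zero (mul_ne_zero hP hx)⟩).ne'
    rw [h] at hne
    obtain ⟨a, -, ha⟩ := Finset.exists_ne_zero_of_sum_ne_zero hne
    have haφ : φ a = (d, e) := by
      by_contra hne
      exact ha (if_neg hne)
    rw [if_pos haφ] at ha
    obtain ⟨c, -, hc⟩ := Finset.exists_ne_zero_of_sum_ne_zero ha
    exact ⟨a, haφ, c, by simpa [M] using left_ne_zero_of_mul hc,
      by simpa [I] using right_ne_zero_of_mul hc⟩
  obtain ⟨a, ha, c, hc, rfl⟩ := key v hv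
  obtain ⟨a', ha', c', hc', rfl⟩ := key w hw
  obtain rfl := hφ (ha.trans ha'.symm)
  rw [hL.right_resolving _ _ _ _ _ hc hc']

theorem card_le_of_oneStepRelations {L L' : LabeledBratteli.{u}} (hL : L.IsLambdaGraphSystem)
    (hL' : L'.IsLambdaGraphSystem) {D E : Type u} [Finite E]
    {φ : L.Alphabet → D × E} {ψ : L'.Alphabet → E × D}
    {K : ∀ n, SymbolicMatrix (L.V (n + 1)) (L'.V n) D}
    {K' : ∀ n, SymbolicMatrix (L'.V (n + 1)) (L.V n) E} (hφ : Injective φ)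
    (h : OneStepRelations L L' φ ψ K K') (n : ℕ) :
    Fintype.card (L.V n) ≤ Nat.card E * Fintype.card (L'.V (n + 1)) := by
  choose j e hje using exists_ne_zero_of_mul_eq hL (h.mul_left n)
  have hinj : Injective fun v => (e v, j v) := by
    intro v w hvw
    obtain ⟨he, hj⟩ := Prod.mk.inj hvw
    -- The relation with the systems exchanged, one level up, supplies a nonzero entry of `K` in the
    -- column `j v`, as `eq_of_mul_eq` requires.
    obtain ⟨i, d, hid⟩ := exists_ne_zero_of_mul_eq hL' (h.mul_right (n + 1)) (j v)
    refine eq_of_mul_eq hL hφ (h.mul_left n) hid (hje v) ?_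
    rw [he, hj]
    exact hje w
  simpa only [Nat.card_prod, ← Nat.card_eq_fintype_card] using
    Nat.card_le_card_of_injective _ hinj

theorem IsLambdaGraphSystem.monotone_card {L : LabeledBratteli.{u}} (hL : L.IsLambdaGraphSystem) :
    Monotone fun n => (Fintype.card (L.V n) : ℝ≥0∞) :=
  monotone_nat_of_le_succ fun n =>
    Nat.cast_le.2 (Fintype.card_le_of_surjective _ (hL.ι_surjective n))

/-- Absorbs the shift of level in `card_le_of_oneStepRelations`. -/
theorem expGrowthSup_succ_of_monotone {v : ℕ → ℝ≥0∞} (hv : Monotone v) :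
    ExpGrowth.expGrowthSup (fun n => v (n + 1)) ≤ ExpGrowth.expGrowthSup v := by
  have h := hv.expGrowthSup_comp (v := fun n => n + 1) (a := 1) ?_ one_ne_zero (by decide)
  · rw [one_mul] at h
    exact h.le
  · have hr : Tendsto (fun n : ℕ => ((n + 1 : ℕ) : ℝ) / n) atTop (𝓝 1) := by
      have h1 : Tendsto (fun n : ℕ => 1 + 1 / (n : ℝ)) atTop (𝓝 (1 + 0)) :=
        tendsto_const_nhds.add tendsto_one_div_atTop_nhds_zero_nat
      rw [add_zero] at h1
      refine h1.congr' ?_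
      filter_upwards [eventually_ne_atTop 0] with n hn
      field_simp
      push_cast
      ring
    have he := (continuous_coe_real_ereal.tendsto 1).comp hr
    simpa [comp_def, EReal.coe_div] using he

theorem OneStepStrongShiftEquivalent.lambdaEntropy_le {L L' : LabeledBratteli.{u}}
    (h : L.OneStepStrongShiftEquivalent L') : L.lambdaEntropy ≤ L'.lambdaEntropy := by
  obtain ⟨hL, hL', D, E, hD, hE, φ, ψ, K, K', hs, hr⟩ := h
  refine le_trans ?_ (expGrowthSup_succ_of_monotone hL'.monotone_card)
  refine ExpGrowth.expGrowthSup_le_of_eventually_le (ENNReal.natCast_ne_top (Nat.card E))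
    (Eventually.of_forall fun n => ?_)
  exact_mod_cast card_le_of_oneStepRelations hL hL' hs.injective_left hr n

theorem StrongShiftEquivalent.lambdaEntropy_eq {L L' : LabeledBratteli.{u}}
    (h : L.StrongShiftEquivalent L') : L.lambdaEntropy = L'.lambdaEntropy := by
  induction h with
  | single h => exact h.lambdaEntropy_le.antisymm h.symm.lambdaEntropy_le
  | tail _ h ih => exact ih.trans (h.lambdaEntropy_le.antisymm h.symm.lambdaEntropy_le)

end LabeledBratteli

section Observables

/-! ### Systems coded by an observable -/

variable {Ω A B C : Type u}

/-- `none` is the value outside the range of `α`, so `B` may be empty. -/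
theorem exists_factor_of_determined {α : Ω → A} {β : Ω → B}
    (h : ∀ ω ω', α ω = α ω' → β ω = β ω') :
    ∃ F : A → Option B, ∀ ω, F (α ω) = some (β ω) := by
  classical
  refine ⟨fun a => if ha : ∃ ω, α ω = a then some (β ha.choose) else none, fun ω => ?_⟩
  have ha : ∃ ω', α ω' = α ω := ⟨ω, rfl⟩
  exact (dif_pos ha).trans (congrArg some (h _ _ ha.choose_spec))

variable [AddAction ℤ Ω]

/-- The itinerary of a point with respect to an observable. -/
def itinerary (α : Ω → A) (ω : Ω) : ℤ → A := fun i => α (i +ᵥ ω)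

theorem shiftInvariant_itinerary_image (α : Ω → A) {S : Set Ω}
    (hS : ∀ k : ℤ, ∀ ω ∈ S, k +ᵥ ω ∈ S) : ShiftInvariant (itinerary α '' S) := by
  rintro k _ ⟨ω, hω, rfl⟩
  exact ⟨k +ᵥ ω, hS k ω hω, funext fun i => congrArg α (add_vadd i k ω).symm⟩

theorem isBipartite_itinerary_image {D E : Type u} {f : A → D × E} {g : B → E × D}
    (hf : Injective f) (hg : Injective g) {α : Ω → A} {β : Ω → B}
    (h : ∀ ω, g (β ω) = ((f (α ω)).2, (f (α ((1 : ℤ) +ᵥ ω))).1)) {S : Set Ω}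
    (hS : ∀ k : ℤ, ∀ ω ∈ S, k +ᵥ ω ∈ S) :
    IsBipartite f g (itinerary α '' S) (itinerary β '' S) where
  injective_left := hf
  injective_right := hg
  shiftInvariant_left := shiftInvariant_itinerary_image α hS
  shiftInvariant_right := shiftInvariant_itinerary_image β hS
  exists_right := by
    rintro _ ⟨ω, hω, rfl⟩
    refine ⟨_, ⟨ω, hω, rfl⟩, fun i => ?_⟩
    simp only [itinerary]
    rw [h, add_comm i 1, add_vadd]
  exists_left := by
    rintro _ ⟨ω, hω, rfl⟩
    refine ⟨_, ⟨(1 : ℤ) +ᵥ ω, hS 1 ω hω, rfl⟩, fun i => ?_⟩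
    simp only [itinerary]
    rw [h, h, vadd_comm i (1 : ℤ) ω, add_comm i 1, add_vadd]

/-- The λ-graph system of the pair of subshifts coded by an observable. -/
noncomputable def observableSystem (S : Set Ω) [Finite A] (α : Ω → A) : LabeledBratteli.{u} :=
  @pairSystem A (Fintype.ofFinite A) ⊥ (itinerary α '' S) (itinerary α '' univ)

/-- The λ-graph systems coded by the observables are strong shift equivalent. -/
def ObservablesEquivalent (S : Set Ω) [Finite A] [Finite B] (α : Ω → A) (β : Ω → B) : Prop :=
  (observableSystem S α).StrongShiftEquivalent (observableSystem S β)

variable {S : Set Ω} [Finite A] [Finite B] [Finite C] {α : Ω → A} {β : Ω → B} {γ : Ω → C}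

theorem ObservablesEquivalent.symm (h : ObservablesEquivalent S α β) :
    ObservablesEquivalent S β α := LabeledBratteli.StrongShiftEquivalent.symm h

theorem ObservablesEquivalent.trans (h : ObservablesEquivalent S α β)
    (h' : ObservablesEquivalent S β γ) : ObservablesEquivalent S α γ :=
  LabeledBratteli.StrongShiftEquivalent.trans h h'

/-- Shifting the observable only permutes the itineraries within the invariant sets that they form.
-/
theorem observableSystem_vadd (hS : ∀ k : ℤ, ∀ ω ∈ S, k +ᵥ ω ∈ S) (α : Ω → A) (k : ℤ) :
    observableSystem S (fun ω => α (k +ᵥ ω)) = observableSystem S α := by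
  have h (T : Set Ω) (hT : ∀ k : ℤ, ∀ ω ∈ T, k +ᵥ ω ∈ T) :
      itinerary (fun ω => α (k +ᵥ ω)) '' T = itinerary α '' T := by
    have he (ω : Ω) : itinerary (fun ω => α (k +ᵥ ω)) ω = itinerary α (k +ᵥ ω) :=
      funext fun i => congrArg α (vadd_comm k i ω)
    ext x
    constructor
    · rintro ⟨ω, hω, rfl⟩
      exact ⟨_, hT k ω hω, (he ω).symm⟩
    · rintro ⟨ω, hω, rfl⟩
      refine ⟨_, hT (-k) ω hω, ?_⟩
      rw [he, vadd_neg_vadd]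
  rw [observableSystem, observableSystem, h S hS, h univ fun _ _ _ => mem_univ _]

theorem ObservablesEquivalent.of_bipartite {D E : Type u} [Finite D] [Finite E] {f : A → D × E}
    {g : B → E × D} (hf : Injective f) (hg : Injective g)
    (h : ∀ ω, g (β ω) = ((f (α ω)).2, (f (α ((1 : ℤ) +ᵥ ω))).1))
    (hS : ∀ k : ℤ, ∀ ω ∈ S, k +ᵥ ω ∈ S) : ObservablesEquivalent S α β := by
  let _ : TopologicalSpace A := ⊥
  let _ : TopologicalSpace B := ⊥
  have : DiscreteTopology A := ⟨rfl⟩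
  have : DiscreteTopology B := ⟨rfl⟩
  let _ := Fintype.ofFinite A
  let _ := Fintype.ofFinite B
  exact .single (oneStepStrongShiftEquivalent_pairSystem
    (isBipartite_itinerary_image hf hg h hS)
    (isBipartite_itinerary_image hf hg h fun _ _ _ => mem_univ _))

/-- Observables that determine each other are equivalent. -/
theorem ObservablesEquivalent.of_forall_eq_iff (hS : ∀ k : ℤ, ∀ ω ∈ S, k +ᵥ ω ∈ S)
    (h : ∀ ω ω', α ω = α ω' ↔ β ω = β ω') : ObservablesEquivalent S α β := by
  obtain ⟨F, hF⟩ := exists_factor_of_determined fun ω ω' => (h ω ω').1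
  obtain ⟨G, hG⟩ := exists_factor_of_determined fun ω ω' => (h ω ω').2
  -- With trivial `D` no neighboring symbol is read. The components `some a` and `some b` make the
  -- specifications injective even off the ranges of the observables.
  refine .of_bipartite (D := PUnit) (E := Option A × Option B)
    (f := fun a => (PUnit.unit, (some a, F a))) (g := fun b => ((G b, some b), PUnit.unit))
    (fun a a' e => ?_) (fun b b' e => ?_) (fun ω => ?_) hS
  · simpa using congrArg (fun p => p.2.1) e
  · simpa using congrArg (fun p => p.1.2) e
  · rw [hF, hG]

/-- Adjoining a function of the next value of an observable. -/
theorem ObservablesEquivalent.prod_next (hS : ∀ k : ℤ, ∀ ω ∈ S, k +ᵥ ω ∈ S) (α : Ω → A)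
    (π : A → B) : ObservablesEquivalent S α fun ω => (α ω, π (α ((1 : ℤ) +ᵥ ω))) :=
  .of_bipartite (f := fun a => (π a, a)) (g := id)
    (fun _ _ e => congrArg Prod.snd e) injective_id (fun _ => rfl) hS

/-- Adjoining a function of the previous value of an observable. -/
theorem ObservablesEquivalent.prod_prev (hS : ∀ k : ℤ, ∀ ω ∈ S, k +ᵥ ω ∈ S) (α : Ω → A)
    (π : A → B) : ObservablesEquivalent S α fun ω => (π (α ((-1 : ℤ) +ᵥ ω)), α ω) := by
  -- The bipartite code yields the wanted observable one time unit late; `observableSystem_vadd`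
  -- removes the delay.
  have h : ObservablesEquivalent S α fun ω => (π (α ω), α ((1 : ℤ) +ᵥ ω)) :=
    .of_bipartite (f := fun a => (a, π a)) (g := id)
      (fun _ _ e => congrArg Prod.fst e) injective_id (fun _ => rfl) hS
  have e := observableSystem_vadd hS (fun ω => (π (α ((-1 : ℤ) +ᵥ ω)), α ω)) 1
  simp only [neg_vadd_vadd] at e
  rw [ObservablesEquivalent, e] at h
  exact h

/-! ### Windows of coordinates and block codes -/

/-- The values of `α` at the times in `[a, b]`, together with the value of `γ`. -/
def windowObservable (α : Ω → A) (γ : Ω → C) (a b : ℤ) (ω : Ω) : (Set.Icc a b → A) × C :=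
  (fun i => α ((i : ℤ) +ᵥ ω), γ ω)

omit [Finite A] [Finite C] in
theorem windowObservable_eq_iff {a b : ℤ} {ω ω' : Ω} :
    windowObservable α γ a b ω = windowObservable α γ a b ω' ↔
      (∀ i, a ≤ i → i ≤ b → α (i +ᵥ ω) = α (i +ᵥ ω')) ∧ γ ω = γ ω' := by
  simp only [windowObservable, Prod.mk.injEq, funext_iff, Subtype.forall, Set.mem_Icc, and_imp]

/-- The last entry of the window, read one step later, is the value at time `b + 1`; `a ≤ b` ensures
that there is a last entry. -/
theorem windowObservable_succ_right (hS : ∀ k : ℤ, ∀ ω ∈ S, k +ᵥ ω ∈ S) {a b : ℤ} (hab : a ≤ b) :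
    ObservablesEquivalent S (windowObservable α γ a b) (windowObservable α γ a (b + 1)) := by
  refine (ObservablesEquivalent.prod_next hS (windowObservable α γ a b)
    fun w => w.1 ⟨b, hab, le_rfl⟩).trans (.of_forall_eq_iff hS fun ω ω' => ?_)
  rw [Prod.mk.injEq, windowObservable_eq_iff, windowObservable_eq_iff]
  simp only [windowObservable, vadd_vadd]
  constructor
  · rintro ⟨⟨h, hγ⟩, hb⟩
    refine ⟨fun i hai hib => ?_, hγ⟩
    rcases hib.lt_or_eq with hib | rfl
    · exact h i hai (by omega)
    · exact hb
  · rintro ⟨h, hγ⟩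
    exact ⟨⟨fun i hai hib => h i hai (by omega), hγ⟩, h (b + 1) (by omega) le_rfl⟩

theorem windowObservable_pred_left (hS : ∀ k : ℤ, ∀ ω ∈ S, k +ᵥ ω ∈ S) {a b : ℤ} (hab : a ≤ b) :
    ObservablesEquivalent S (windowObservable α γ a b) (windowObservable α γ (a - 1) b) := by
  refine (ObservablesEquivalent.prod_prev hS (windowObservable α γ a b)
    fun w => w.1 ⟨a, le_rfl, hab⟩).trans (.of_forall_eq_iff hS fun ω ω' => ?_)
  rw [Prod.mk.injEq, windowObservable_eq_iff, windowObservable_eq_iff]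
  simp only [windowObservable, vadd_vadd]
  constructor
  · rintro ⟨ha, h, hγ⟩
    refine ⟨fun i hai hib => ?_, hγ⟩
    rcases hai.lt_or_eq with hai | rfl
    · exact h i (by omega) hib
    · exact ha
  · rintro ⟨h, hγ⟩
    exact ⟨h (a - 1) le_rfl (by omega), fun i hai hib => h i (by omega) hib, hγ⟩

theorem windowObservable_symmetric (hS : ∀ k : ℤ, ∀ ω ∈ S, k +ᵥ ω ∈ S) (m : ℕ) :
    ObservablesEquivalent S (windowObservable α γ 0 0) (windowObservable α γ (-m) m) := by
  induction m with
  | zero =>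
    -- Reflexivity is itself a one-step equivalence here, since `TransGen` does not supply it.
    refine .of_forall_eq_iff hS fun ω ω' => ?_
    simp only [windowObservable_eq_iff, Nat.cast_zero, neg_zero]
  | succ m ih =>
    have h := (ih.trans (windowObservable_succ_right hS (by omega))).trans
      (windowObservable_pred_left hS (by omega))
    rwa [show (-(m : ℤ) - 1) = -((m + 1 : ℕ) : ℤ) by push_cast; ring,
      show ((m : ℤ) + 1) = ((m + 1 : ℕ) : ℤ) by push_cast; ring] at h

/-- The value of `β` is a function of the values of `α` at the times in a bounded interval. -/
def IsBlockCode (α : Ω → A) (β : Ω → B) : Prop :=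
  ∃ m : ℕ, ∀ ω ω', (∀ i : ℤ, -m ≤ i → i ≤ m → α (i +ᵥ ω) = α (i +ᵥ ω')) → β ω = β ω'

/-- The window of `α` grows to `[-m, m]`, where `β` can be adjoined as it is determined; then the
window shrinks again while `β` is carried along unchanged. -/
theorem IsBlockCode.observablesEquivalent_prod (hS : ∀ k : ℤ, ∀ ω ∈ S, k +ᵥ ω ∈ S)
    (h : IsBlockCode α β) : ObservablesEquivalent S α fun ω => (α ω, β ω) := by
  obtain ⟨m, hm⟩ := h
  have zero_window (i : ℤ) (h0 : 0 ≤ i) (h0' : i ≤ 0) (ω : Ω) : α (i +ᵥ ω) = α ω := by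
    rw [h0'.antisymm h0, zero_vadd]
  have h1 : ObservablesEquivalent S α
      (windowObservable α (fun _ : Ω => PUnit.unit.{u + 1}) 0 0) :=
    .of_forall_eq_iff hS fun ω ω' => by
      rw [windowObservable_eq_iff]
      refine ⟨fun h => ⟨fun i h0 h0' => ?_, rfl⟩, fun h => ?_⟩
      · rw [zero_window i h0 h0', zero_window i h0 h0', h]
      · simpa using h.1 0 le_rfl le_rfl
  have h2 : ObservablesEquivalent S
      (windowObservable α (fun _ : Ω => PUnit.unit.{u + 1}) (-m) m)
      (windowObservable α β (-m) m) :=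
    .of_forall_eq_iff hS fun ω ω' => by
      rw [windowObservable_eq_iff, windowObservable_eq_iff]
      exact ⟨fun h => ⟨h.1, hm ω ω' h.1⟩, fun h => ⟨h.1, rfl⟩⟩
  have h3 : ObservablesEquivalent S (windowObservable α β 0 0) fun ω => (α ω, β ω) :=
    .of_forall_eq_iff hS fun ω ω' => by
      rw [windowObservable_eq_iff, Prod.mk.injEq]
      refine and_congr_left fun _ => ⟨fun h => ?_, fun h i h0 h0' => ?_⟩
      · simpa using h 0 le_rfl le_rfl
      · rw [zero_window i h0 h0', zero_window i h0 h0', h]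
  exact ((h1.trans (windowObservable_symmetric hS m)).trans h2).trans
    ((windowObservable_symmetric hS m).symm.trans h3)

/-- Observables that are block codes of each other are equivalent. -/
theorem IsBlockCode.observablesEquivalent (hS : ∀ k : ℤ, ∀ ω ∈ S, k +ᵥ ω ∈ S)
    (h : IsBlockCode α β) (h' : IsBlockCode β α) : ObservablesEquivalent S α β :=
  ((h.observablesEquivalent_prod hS).trans (.of_forall_eq_iff hS fun ω ω' => by
    rw [Prod.mk.injEq, Prod.mk.injEq, and_comm])).trans (h'.observablesEquivalent_prod hS).symm

end Observables

section Conjugacy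

open SymbolicDynamics.FullShift

variable {A B : Type u} [TopologicalSpace A] [TopologicalSpace B]

/-! ### Conjugacies of subshifts -/

/-- The action of `ℤ` on a subshift by powers of the shift. -/
@[reducible]
def subshiftAction (X : Subshift A ℤ) : AddAction ℤ X.carrier where
  vadd k x := ⟨shift k (x : ℤ → A), X.mapsTo k x.2⟩
  zero_vadd x := Subtype.ext (shift_zero (x : ℤ → A))
  add_vadd k l x := Subtype.ext (by
    rw [add_comm]
    exact shift_add l k (x : ℤ → A))

theorem equivariant_of_equivariant_one {X : Subshift A ℤ} {X' : Subshift B ℤ}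
    {φ : X.carrier → X'.carrier}
    (hφ : ∀ x : X.carrier, (φ ⟨shift 1 (x : ℤ → A), X.mapsTo 1 x.2⟩ : ℤ → B) =
      shift 1 (φ x : ℤ → B)) (k : ℤ) :
    ∀ x : X.carrier, (φ ⟨shift k (x : ℤ → A), X.mapsTo k x.2⟩ : ℤ → B) =
      shift k (φ x : ℤ → B) := by
  induction k with
  | zero =>
    intro x
    simp
  | succ k ih =>
    intro x
    have h := hφ ⟨shift k (x : ℤ → A), X.mapsTo k x.2⟩
    simp only [ih x, ← shift_add] at h
    exact h
  | pred k ih =>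
    intro x
    -- Equivariance at the point one step further back, then undone by `shift (-1)`.
    have h := hφ ⟨shift (-k - 1) (x : ℤ → A), X.mapsTo _ x.2⟩
    simp only [← shift_add, sub_add_cancel] at h
    rw [ih x] at h
    have h' := congrArg (shift (-1 : ℤ)) h
    rw [← shift_add, ← shift_add, add_neg_cancel, shift_zero] at h'
    rw [← h', sub_eq_add_neg]

variable [DiscreteTopology A] [DiscreteTopology B]

/-- A continuous observable on a compact set of sequences depends on finitely many coordinates. -/
theorem exists_window_of_continuous [Finite A] {K : Set (ℤ → A)} (hK : IsClosed K) {h : K → B}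
    (hh : Continuous h) : ∃ m : ℕ, ∀ x y : K,
      (∀ i : ℤ, -m ≤ i → i ≤ m → (x : ℤ → A) i = (y : ℤ → A) i) → h x = h y := by
  have : CompactSpace K := isCompact_iff_compactSpace.1 hK.isCompact
  -- The pairs separated by `h` form a compact set, covered by the increasing open sets of pairs
  -- that differ somewhere in `[-m, m]`.
  have hclosed : IsClosed {p : K × K | h p.1 ≠ h p.2} := by
    have hc : Continuous fun p : K × K => (h p.1, h p.2) := by fun_prop
    exact (isClosed_discrete {q : B × B | q.1 ≠ q.2}).preimage hc
  obtain ⟨m, hm⟩ := hclosed.isCompact.elim_directed_cover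
    (fun m : ℕ => {p : K × K | ∃ i : ℤ, (-m ≤ i ∧ i ≤ m) ∧ (p.1 : ℤ → A) i ≠ (p.2 : ℤ → A) i})
    (fun m => by
      have he : {p : K × K | ∃ i : ℤ, (-m ≤ i ∧ i ≤ m) ∧ (p.1 : ℤ → A) i ≠ (p.2 : ℤ → A) i} =
          ⋃ i ∈ Set.Icc (-m : ℤ) m, {p : K × K | (p.1 : ℤ → A) i ≠ (p.2 : ℤ → A) i} := by
        ext p
        simp
      rw [he]
      refine isOpen_biUnion fun i _ => ?_
      have hc : Continuous fun p : K × K => ((p.1 : ℤ → A) i, (p.2 : ℤ → A) i) :=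
        ((continuous_apply i).comp (continuous_subtype_val.comp continuous_fst)).prodMk
          ((continuous_apply i).comp (continuous_subtype_val.comp continuous_snd))
      exact (isOpen_discrete {q : A × A | q.1 ≠ q.2}).preimage hc)
    (fun p hp => by
      have hne : (p.1 : ℤ → A) ≠ p.2 := fun e => hp (congrArg h (Subtype.ext e))
      obtain ⟨i, hi⟩ := ne_iff.1 hne
      exact mem_iUnion.2 ⟨i.natAbs, i, by omega, hi⟩)
    (directed_of_isDirected_le fun m n hmn p => by
      rintro ⟨i, hi, hne⟩
      exact ⟨i, by omega, hne⟩)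
  refine ⟨m, fun x y hxy => ?_⟩
  by_contra hne
  obtain ⟨i, ⟨h1, h2⟩, h3⟩ := hm (show (x, y) ∈ {p : K × K | h p.1 ≠ h p.2} from hne)
  exact h3 (hxy i h1 h2)

variable [Fintype A] [Fintype B]

theorem strongShiftEquivalent_of_conjugacy (X : Subshift A ℤ) (X' : Subshift B ℤ)
    (φ : X.carrier ≃ₜ X'.carrier)
    (hφ : ∀ x : X.carrier, (φ ⟨shift 1 (x : ℤ → A), X.mapsTo 1 x.2⟩ : ℤ → B) =
      shift 1 (φ x : ℤ → B))
    (Y : Subshift A ℤ) (hYX : Y.carrier ⊆ X.carrier) :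
    (pairSystem Y.carrier X.carrier).StrongShiftEquivalent
      (pairSystem ((fun x : X.carrier => (φ x : ℤ → B)) '' {x | (x : ℤ → A) ∈ Y.carrier})
        X'.carrier) := by
  let _ := subshiftAction X
  have hφ' := equivariant_of_equivariant_one hφ
  -- The itineraries of `x` under these two observables are `x` and `φ x`, so the systems they code
  -- are the two pair systems.
  let α : X.carrier → A := fun x => (x : ℤ → A) 0
  let β : X.carrier → B := fun x => (φ x : ℤ → B) 0
  have hα (x : X.carrier) (i : ℤ) : α (i +ᵥ x) = (x : ℤ → A) i :=
    congrArg (x : ℤ → A) (add_zero i)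
  have hβ (x : X.carrier) (i : ℤ) : β (i +ᵥ x) = (φ x : ℤ → B) i :=
    (congrFun (hφ' i x) 0).trans (congrArg (φ x : ℤ → B) (add_zero i))
  have hαβ : IsBlockCode α β := by
    obtain ⟨m, hm⟩ := exists_window_of_continuous X.isClosed (h := β)
      ((continuous_apply 0).comp (continuous_subtype_val.comp φ.continuous))
    refine ⟨m, fun x y h => hm x y fun i h1 h2 => ?_⟩
    rw [← hα, ← hα]
    exact h i h1 h2
  have hβα : IsBlockCode β α := by
    obtain ⟨m, hm⟩ := exists_window_of_continuous X'.isClosed (h := fun y => α (φ.symm y))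
      ((continuous_apply 0).comp (continuous_subtype_val.comp φ.symm.continuous))
    refine ⟨m, fun x y h => ?_⟩
    have := hm (φ x) (φ y) fun i h1 h2 => by
      rw [← hβ, ← hβ]
      exact h i h1 h2
    simpa only [Homeomorph.symm_apply_apply] using this
  have hiα (x : X.carrier) : itinerary α x = x := funext (hα x)
  have hiβ (x : X.carrier) : itinerary β x = φ x := funext (hβ x)
  have key : ObservablesEquivalent {x : X.carrier | (x : ℤ → A) ∈ Y.carrier} α β :=
    hαβ.observablesEquivalent (fun k x hx => Y.mapsTo k hx) hβα
  have hY : itinerary α '' {x : X.carrier | (x : ℤ → A) ∈ Y.carrier} = Y.carrier := by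
    ext y
    simp only [mem_image, mem_ofPred_eq, hiα]
    exact ⟨by rintro ⟨x, hx, rfl⟩; exact hx, fun hy => ⟨⟨y, hYX hy⟩, hy, rfl⟩⟩
  have hX : itinerary α '' univ = X.carrier := by
    simp only [image_univ, funext hiα, Subtype.range_coe]
  have hY' : itinerary β '' {x : X.carrier | (x : ℤ → A) ∈ Y.carrier} =
      (fun x : X.carrier => (φ x : ℤ → B)) '' {x | (x : ℤ → A) ∈ Y.carrier} :=
    image_congr fun x _ => hiβ x
  have hX' : itinerary β '' univ = X'.carrier := by
    rw [image_univ, funext hiβ]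
    exact (φ.surjective.range_comp Subtype.val).trans Subtype.range_coe
  rw [ObservablesEquivalent, observableSystem, observableSystem, hY, hX, hY', hX'] at key
  convert key using 2
  · exact DiscreteTopology.eq_bot
  · exact DiscreteTopology.eq_bot

end Conjugacy

end SubshiftPair

theorem theorem4p2 {A B : Type u}
    [Fintype A] [TopologicalSpace A] [DiscreteTopology A]
    [Fintype B] [TopologicalSpace B] [DiscreteTopology B]
    (X : SymbolicDynamics.FullShift.Subshift A ℤ)
    (X' : SymbolicDynamics.FullShift.Subshift B ℤ)
    (φ : X.carrier ≃ₜ X'.carrier)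
    (hφ : ∀ x : X.carrier,
      (φ ⟨SymbolicDynamics.FullShift.shift 1 (x : ℤ → A), X.mapsTo 1 x.2⟩ : ℤ → B) =
        SymbolicDynamics.FullShift.shift 1 (φ x : ℤ → B))
    (Y : SymbolicDynamics.FullShift.Subshift A ℤ) (hYX : Y.carrier ⊆ X.carrier)
    (Y' : Set (ℤ → B))
    (hY' : Y' = (fun x : X.carrier => (φ x : ℤ → B)) '' {x | (x : ℤ → A) ∈ Y.carrier}) :
    SubshiftPair.LabeledBratteli.StrongShiftEquivalent
        (SubshiftPair.pairSystem Y.carrier X.carrier)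
        (SubshiftPair.pairSystem Y' X'.carrier) ∧
      (∀ L : SubshiftPair.LabeledBratteli.{u},
        SubshiftPair.LabeledBratteli.StrongShiftEquivalent
            (SubshiftPair.pairSystem Y.carrier X.carrier) L ↔
          SubshiftPair.LabeledBratteli.StrongShiftEquivalent
            (SubshiftPair.pairSystem Y' X'.carrier) L) ∧
      SubshiftPair.separationEntropy Y.carrier X.carrier =
        SubshiftPair.separationEntropy Y' X'.carrier := by
  subst hY'
  have h := SubshiftPair.strongShiftEquivalent_of_conjugacy X X' φ hφ Y hYX
  exact ⟨h, fun L => ⟨h.symm.trans, h.trans⟩, h.lambdaEntropy_eq⟩
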